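/- **Conventions.** $\mathbb H$ is the hyperbolic upper half-plane with distance $d$. For a subgroup $\Gamma\subset SL(2,\mathbb R)$ acting on $\mathbb H$ by Möbius transformations, $S=\Gamma\backslash\mathbb H$ carries the quotient distance $d_S$ (least distance between lifts), and $T^1S=\Gamma\backslash T^1\mathbb H$ carries the quotient topology, the geodesic flow $g_t$ and the horocycle flow $h_s$ (which moves a vector along the horocycle through its base point centred at its forward endpoint). Let $\Omega_h\subset T^1S$ be the non-wandering set of $h_{\mathbb R}$. For $u\in T^1S$, $u(t)\in S$ is the base point of $g_tu$, and $$\mathrm{Inj}(x)=\inf_{\gamma\in\Gamma\setminus\{\pm 1\}}d(\tilde x,\gamma\tilde x),\qquad \mathrm{Inj}\,u(\mathbb R^+)=\liminf_{t\to+\infty}\mathrm{Inj}(u(t))\in[0,+\infty],$$ where $\tilde x$ is a lift of $x\in S$ (the infimum does not depend on it). The ray $u(\mathbb R^+)$ is *infinite quasi-minimizing* if there is $C\ge 0$ with $d_S(u(0),u(t))\ge t-C$ for all $t>0$, and $u$ lies in $\Omega_h$ and is not $h_{\mathbb R}$-periodic. A sequence $(\gamma_n)_{n\in\mathbb N}$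 of hyperbolic elements of $SL(2,\mathbb R)$ presents a *flute* if * it generates an infinite Schottky group: for some $o\in\mathbb H$ the closed half-planes $\{z: d(z,\gamma_n^{\pm1}o)\le d(z,o)\}$, over all $n$ and both signs, are pairwise at positive distance; and * its axes are nested: they bound half-planes $E_n$ such that each closed half-plane $E_n$ is contained in the interior of $E_{n+1}$. The flute is *untwisted* if in addition the segments $a_n$ that join the axes of $\gamma_n$ and $\gamma_{n+1}$ orthogonally to both all lie on one half-geodesic of $\mathbb H$. **Theorem.** There exist an untwisted flute $F=\Gamma\backslash\mathbb H$, with $\Gamma=\langle\gamma_n : n\in\mathbb N\rangle$, and a vector $u\in\Omega_h\subset T^1F$ with $u(\mathbb R^+)$ infinite quasi-minimizing, such that: 1. the orbit $h_{\mathbb R}u$ is neither closed in $T^1F$ nor dense in $\Omega_h$; 2. $\mathrm{Inj}\,u(\mathbb R^+)=+\infty$; 3. $T_u=\{t\in\mathbb R : g_tu\in\overline{h_{\mathbb R}u}\}=\{0\}$. Moreover, $F$ can be obtained by the following construction: there are numbers $\epsilon_n>0$ with $\epsilon_n\to0$ and points $p_n\in\mathbb H$ with $\mathrm{Re}\,p_n>0$,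 $\mathrm{Re}\,p_n\to+\infty$ and $\mathrm{Im}\,p_n=e^{-\epsilon_n}$, such that for every $n$ the isometry $\gamma_n$ is the reflection across the perpendicular bisector of $[i,p_n]$ followed by the reflection across the geodesic with endpoints $-1$ and $1$. -/

import Mathlib

open scoped MatrixGroups Topology ENNReal
open UpperHalfPlane Filter

noncomputable section

namespace Flute

/-! ## The unit tangent bundle of the hyperbolic plane -/

/-- The unit tangent bundle of the hyperbolic plane: pairs of a base point `z` and a tangent
vector `v`, seen as a complex number, whose hyperbolic norm `|v| / Im z` is one. -/
def UTH : Type := {p : ℍ × ℂ // ‖p.2‖ = p.1.im}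

instance : TopologicalSpace UTH := inferInstanceAs (TopologicalSpace {p : ℍ × ℂ // ‖p.2‖ = p.1.im})

/-- The base point of a unit tangent vector. -/
def UTH.base (u : UTH) : ℍ := u.1.1

/-- The direction of a unit tangent vector. -/
def UTH.dir (u : UTH) : ℂ := u.1.2

theorem UTH.ext {u v : UTH} (h1 : u.base = v.base) (h2 : u.dir = v.dir) : u = v :=
  Subtype.ext (Prod.ext h1 h2)

theorem den_ne_zero (g : SL(2, ℝ)) (z : ℍ) : ((g 1 0 : ℝ) : ℂ) * z + (g 1 1 : ℝ) ≠ 0 :=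
  denom_ne_zero (g : GL (Fin 2) ℝ) z

theorem im_smul' (g : SL(2, ℝ)) (z : ℍ) :
    (g • z).im = z.im / ‖((g 1 0 : ℝ) : ℂ) * z + (g 1 1 : ℝ)‖ ^ 2 := by
  have h := UpperHalfPlane.im_smul_eq_div_normSq (g : GL (Fin 2) ℝ) z
  rw [← Complex.normSq_eq_norm_sq]
  have e : (g • z) = (g : GL (Fin 2) ℝ) • z := rfl
  rw [e, h]
  simp [denom]

theorem den_mul (g h : SL(2, ℝ)) (z : ℍ) :
    (((g * h) 1 0 : ℝ) : ℂ) * z + ((g * h) 1 1 : ℝ) =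
      (((g 1 0 : ℝ) : ℂ) * (h • z : ℍ) + (g 1 1 : ℝ)) *
        (((h 1 0 : ℝ) : ℂ) * z + (h 1 1 : ℝ)) := by
  have hne := den_ne_zero h z
  rw [specialLinearGroup_apply]
  simp [Matrix.mul_apply, Fin.sum_univ_two]
  field_simp
  ring

/-- `SL(2, ℝ)` acts on the unit tangent bundle by the differentials of its Möbius
transformations; the derivative of `z ↦ (a z + b) / (c z + d)` is `1 / (c z + d) ^ 2`. -/
instance : MulAction SL(2, ℝ) UTH where
  smul g u := ⟨(g • u.1.1, u.1.2 / (((g 1 0 : ℝ) : ℂ) * u.1.1 + (g 1 1 : ℝ)) ^ 2), by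
    simp only [norm_div, norm_pow, u.2, im_smul']⟩
  one_smul u := by
    apply Subtype.ext
    apply Prod.ext
    · exact one_smul _ _
    · change u.1.2 / _ = u.1.2
      simp
  mul_smul g h u := by
    apply Subtype.ext
    apply Prod.ext
    · exact mul_smul _ _ _
    · change u.1.2 / _ = (u.1.2 / _) / _
      rw [den_mul, mul_pow, div_div, mul_comm]
      rfl

theorem base_smul (g : SL(2, ℝ)) (u : UTH) : (g • u).base = g • u.base := rfl

theorem dir_smul (g : SL(2, ℝ)) (u : UTH) :
    (g • u).dir = u.dir / (((g 1 0 : ℝ) : ℂ) * u.base + (g 1 1 : ℝ)) ^ 2 := rfl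

/-- The upward unit vector at the point `s + e ^ t * i`. -/
def upward (s t : ℝ) : UTH :=
  ⟨(⟨⟨s, Real.exp t⟩, Real.exp_pos t⟩, ⟨0, Real.exp t⟩), by
    have : (⟨0, Real.exp t⟩ : ℂ) = (Real.exp t : ℂ) * Complex.I := by
      apply Complex.ext <;> simp [-Complex.ofReal_exp]
    simp only [this]
    rw [norm_mul, Complex.norm_I, mul_one, Complex.norm_real, Real.norm_eq_abs,
      abs_of_pos (Real.exp_pos t)]
    rfl⟩

/-- Every unit tangent vector is the image of the upward vector at `i` under some isometry. -/
theorem exists_frame (u : UTH) : ∃ g : SL(2, ℝ), g • upward 0 0 = u := by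
  have hpos : 0 < u.base.im := u.base.im_pos
  have hn : ‖u.dir‖ = u.base.im := u.2
  have hv : u.dir ≠ 0 := by
    intro h
    rw [h, norm_zero] at hn
    exact hpos.ne hn
  obtain ⟨w, hw⟩ := IsAlgClosed.exists_pow_nat_eq (Complex.I / u.dir) (n := 2) (by norm_num)
  have hw0 : w ≠ 0 := by
    rintro rfl
    have : Complex.I / u.dir ≠ 0 := div_ne_zero Complex.I_ne_zero hv
    exact this (by rw [← hw]; simp)
  have hnorm : w.re * w.re + w.im * w.im = 1 / u.base.im := by
    have h := congrArg norm hw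
    rw [norm_pow, norm_div, Complex.norm_I, hn] at h
    rw [← h, ← Complex.normSq_eq_norm_sq, Complex.normSq_apply]
  have hdet : (!![((u.base : ℂ) * w).im, ((u.base : ℂ) * w).re; w.im, w.re]).det = 1 := by
    rw [Matrix.det_fin_two_of]
    simp only [Complex.mul_im, Complex.mul_re, UpperHalfPlane.coe_re, UpperHalfPlane.coe_im]
    have : u.base.im * (w.re * w.re + w.im * w.im) = 1 := by
      rw [hnorm]; field_simp
    linear_combination this
  have hI : ((upward 0 0).base : ℂ) = Complex.I := by
    apply Complex.ext
    · rfl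
    · exact Real.exp_zero
  have hD : (upward 0 0).dir = Complex.I := by
    apply Complex.ext
    · rfl
    · exact Real.exp_zero
  have hc : ((w.im : ℝ) : ℂ) * Complex.I + (w.re : ℝ) = w := by
    apply Complex.ext <;> simp
  have hc' : ((((u.base : ℂ) * w).im : ℝ) : ℂ) * Complex.I + (((u.base : ℂ) * w).re : ℝ) =
      (u.base : ℂ) * w := by
    apply Complex.ext <;> simp
  obtain ⟨g, g00, g01, g10, g11⟩ : ∃ g : SL(2, ℝ), g 0 0 = ((u.base : ℂ) * w).im ∧
      g 0 1 = ((u.base : ℂ) * w).re ∧ g 1 0 = w.im ∧ g 1 1 = w.re :=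
    ⟨⟨_, hdet⟩, rfl, rfl, rfl, rfl⟩
  refine ⟨g, UTH.ext ?_ ?_⟩
  · apply UpperHalfPlane.ext
    rw [base_smul, coe_specialLinearGroup_apply, hI]
    simp only [g00, g01, g10, g11, Algebra.algebraMap_self, RingHom.id_apply]
    rw [hc, hc']
    field_simp
  · rw [dir_smul, hI, hD]
    rw [g10, g11, hc, hw]
    have := Complex.I_ne_zero
    field_simp

/-- An isometry that carries the upward vector at `i` to `u`. -/
def frame (u : UTH) : SL(2, ℝ) := (exists_frame u).choose

theorem frame_smul (u : UTH) : frame u • upward 0 0 = u := (exists_frame u).choose_spec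

/-- Two isometries with the same effect on one unit tangent vector have the same effect on
all of them, so that the flows below do not depend on the choice of `frame`. -/
theorem smul_eq_of_smul_upward_eq (g h : SL(2, ℝ)) (e : g • upward 0 0 = h • upward 0 0)
    (v : UTH) : g • v = h • v := by
  suffices H : ∀ k : SL(2, ℝ), k • upward 0 0 = upward 0 0 → k • v = v by
    have := H (h⁻¹ * g) (by rw [mul_smul, e, inv_smul_smul])
    rw [mul_smul, inv_smul_eq_iff] at this
    exact this
  intro k hk
  have hI : ((upward 0 0).base : ℂ) = Complex.I := by
    apply Complex.ext
    · rfl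
    · exact Real.exp_zero
  have hD : (upward 0 0).dir = Complex.I := by
    apply Complex.ext
    · rfl
    · exact Real.exp_zero
  have h1 := congrArg (fun u : UTH => (u.base : ℂ)) hk
  have h2 := congrArg UTH.dir hk
  have hden := den_ne_zero k (upward 0 0).base
  simp only [base_smul, specialLinearGroup_apply, hI] at h1
  rw [dir_smul, hI, hD] at h2
  rw [hI] at hden
  have h3 : ((k 1 0 : ℝ) * Complex.I + (k 1 1 : ℝ)) ^ 2 = 1 := by
    have hp := pow_ne_zero 2 hden
    rw [div_eq_iff hp] at h2
    exact (mul_left_cancel₀ Complex.I_ne_zero (by rw [mul_one]; exact h2)).symm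
  have hdet : k 0 0 * k 1 1 - k 0 1 * k 1 0 = 1 := by
    have := k.det_coe
    rwa [Matrix.det_fin_two] at this
  simp only [Algebra.algebraMap_self, RingHom.id_apply] at h1
  rw [div_eq_iff hden] at h1
  have a1 := congrArg Complex.re h1
  have a2 := congrArg Complex.im h1
  simp at a1 a2
  have b1 := congrArg Complex.re h3
  have b2 := congrArg Complex.im h3
  simp [pow_two] at b1 b2
  have hc : k 1 0 = 0 := by
    by_contra hne
    have hd : k 1 1 = 0 := by
      rcases mul_eq_zero.mp (show k 1 0 * k 1 1 = 0 by linarith) with h | h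
      · exact absurd h hne
      · exact h
    rw [hd] at b1
    nlinarith [mul_self_nonneg (k 1 0)]
  have hb : k 0 1 = 0 := by rw [a1, hc, neg_zero]
  rw [hc] at b1
  have hd2 : k 1 1 * k 1 1 = 1 := by linarith
  apply UTH.ext
  · apply UpperHalfPlane.ext
    have hne : ((k 1 1 : ℝ) : ℂ) ≠ 0 := by
      intro h
      rw [Complex.ofReal_eq_zero] at h
      rw [h] at hd2
      norm_num at hd2
    rw [base_smul, specialLinearGroup_apply]
    simp [hb, hc, a2]
    field_simp
  · rw [dir_smul, hc]
    have : ((k 1 1 : ℝ) : ℂ) ^ 2 = 1 := by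
      rw [pow_two]; exact_mod_cast hd2
    simp [this]

/-! ## The geodesic and horocycle flows on the unit tangent bundle of the plane -/

/-- The geodesic flow. The geodesic ray that starts at `i` with upward direction is
`t ↦ e ^ t * i`; all others are its images under isometries. -/
def geodesicFlowH (t : ℝ) (u : UTH) : UTH := frame u • upward 0 t

/-- The horocycle flow. It moves the upward vector at `i` to the upward vector at `i + s`, along
the horocycle `Im z = 1` centred at the endpoint `∞` of that vector; it commutes with isometries. -/
def horocycleFlowH (s : ℝ) (u : UTH) : UTH := frame u • upward s 0

theorem geodesicFlowH_smul (t : ℝ) (g : SL(2, ℝ)) (u : UTH) :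
    geodesicFlowH t (g • u) = g • geodesicFlowH t u := by
  unfold geodesicFlowH
  rw [← mul_smul]
  exact smul_eq_of_smul_upward_eq _ _ (by rw [mul_smul, frame_smul, frame_smul]) _

theorem horocycleFlowH_smul (s : ℝ) (g : SL(2, ℝ)) (u : UTH) :
    horocycleFlowH s (g • u) = g • horocycleFlowH s u := by
  unfold horocycleFlowH
  rw [← mul_smul]
  exact smul_eq_of_smul_upward_eq _ _ (by rw [mul_smul, frame_smul, frame_smul]) _

/-- The half-geodesic of the plane with initial vector `u`. -/
def ray (u : UTH) : Set ℍ := {z | ∃ t : ℝ, 0 ≤ t ∧ z = (geodesicFlowH t u).base}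

/-! ## Geometry of the hyperbolic plane -/

/-- The perpendicular bisector of `p` and `q`. For `p ≠ q` this is a complete geodesic, and every
complete geodesic has this form. -/
def bisector (p q : ℍ) : Set ℍ := {z | dist z p = dist z q}

/-- The closed half-plane of the points that are at least as close to `p` as to `q`. -/
def closedHalfPlane (p q : ℍ) : Set ℍ := {z | dist z p ≤ dist z q}

/-- The open half-plane of the points that are closer to `p` than to `q`. -/
def openHalfPlane (p q : ℍ) : Set ℍ := {z | dist z p < dist z q}

/-- The geodesic segment between two points. -/
def geodSegment (x y : ℍ) : Set ℍ := {z | dist x z + dist z y = dist x y}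

/-- The axis of a hyperbolic isometry: the geodesic of the points of least displacement. -/
def axis (g : SL(2, ℝ)) : Set ℍ := {z | ∀ w : ℍ, dist z (g • z) ≤ dist w (g • w)}

/-- The segment from `x` to `y` joins the geodesics `A` and `B` and is orthogonal to both: each
endpoint is the foot of the perpendicular dropped from the other one. -/
def IsCommonPerpendicular (A B : Set ℍ) (x y : ℍ) : Prop :=
  x ∈ A ∧ y ∈ B ∧ (∀ x' ∈ A, dist y x ≤ dist y x') ∧ (∀ y' ∈ B, dist x y ≤ dist x y')

/-- `R` is the reflection across the geodesic `A`: the isometry whose fixed points are exactly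
the points of `A`. -/
def IsReflection (A : Set ℍ) (R : ℍ ≃ᵢ ℍ) : Prop := {z | R z = z} = A

/-! ## Flutes -/

/-- The half-planes `{z | d(z, g o) ≤ d(z, o)}` of an infinite Schottky group, where `g` runs over
the generators `γ n` (second index `true`) and their inverses (second index `false`). -/
def schottkyHalfPlane (γ : ℕ → SL(2, ℝ)) (o : ℍ) (k : ℕ × Bool) : Set ℍ :=
  closedHalfPlane ((if k.2 then γ k.1 else (γ k.1)⁻¹) • o) o

/-- The sequence `γ` of hyperbolic isometries generates an infinite Schottky group: for some base
point the half-planes of the generators and of their inverses are at positive distance from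
each other, which means that their closures in the closed disc are pairwise disjoint. -/
def IsInfiniteSchottky (γ : ℕ → SL(2, ℝ)) : Prop :=
  (∀ n, Matrix.IsHyperbolic (γ n : Matrix (Fin 2) (Fin 2) ℝ)) ∧
  ∃ o : ℍ, Pairwise fun k l => Metric.AreSeparated (schottkyHalfPlane γ o k) (schottkyHalfPlane γ o l)

/-- The axes of the `γ n` are nested: they bound an increasing sequence of half-planes, with
pairwise disjoint boundaries. -/
def HasNestedAxes (γ : ℕ → SL(2, ℝ)) : Prop :=
  ∃ p q : ℕ → ℍ, (∀ n, p n ≠ q n ∧ axis (γ n) = bisector (p n) (q n)) ∧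
    ∀ n, closedHalfPlane (p n) (q n) ⊆ openHalfPlane (p (n + 1)) (q (n + 1))

/-- `γ` presents a flute. -/
def IsFlute (γ : ℕ → SL(2, ℝ)) : Prop := IsInfiniteSchottky γ ∧ HasNestedAxes γ

/-- `γ` presents an untwisted flute: the common perpendicular segments of the consecutive axes all
lie on one half-geodesic. -/
def IsUntwistedFlute (γ : ℕ → SL(2, ℝ)) : Prop :=
  IsFlute γ ∧ ∃ w : UTH, ∀ n, ∃ x y : ℍ,
    IsCommonPerpendicular (axis (γ n)) (axis (γ (n + 1))) x y ∧ geodSegment x y ⊆ ray w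

/-- The group generated by the sequence `γ`. -/
def groupOf (γ : ℕ → SL(2, ℝ)) : Subgroup SL(2, ℝ) := Subgroup.closure (Set.range γ)

/-- The construction by perpendicular bisectors and a reflection: for points `p n` with
`Re (p n) > 0`, `Re (p n) → ∞` and `Im (p n) = e ^ (- ε n)`, where `ε n > 0` tends to zero, `γ n` is the
reflection across the perpendicular bisector of `i` and `p n`, followed by the reflection
across the geodesic with endpoints `-1` and `1`. -/
def IsBisectorConstruction (γ : ℕ → SL(2, ℝ)) : Prop :=
  ∃ (ε : ℕ → ℝ) (p : ℕ → ℍ) (j : ℍ ≃ᵢ ℍ),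
    (∀ n, 0 < ε n) ∧ Tendsto ε atTop (𝓝 0) ∧
    (∀ n, 0 < (p n).re ∧ (p n).im = Real.exp (-ε n)) ∧
    Tendsto (fun n => (p n).re) atTop atTop ∧
    IsReflection {z : ℍ | ‖(z : ℂ)‖ = 1} j ∧
    ∀ n, ∃ R : ℍ ≃ᵢ ℍ, IsReflection (bisector I (p n)) R ∧ ∀ z : ℍ, γ n • z = j (R z)

/-! ## The quotient surface, its unit tangent bundle and the flows on it -/

variable (Γ : Subgroup SL(2, ℝ))

/-- The surface `Γ \ ℍ`. -/
abbrev Surface : Type := MulAction.orbitRel.Quotient Γ ℍ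

/-- The unit tangent bundle of the surface `Γ \ ℍ`, as the quotient of that of `ℍ` (with the
quotient topology). -/
abbrev UTS : Type := MulAction.orbitRel.Quotient Γ UTH

variable {Γ}

/-- The geodesic flow on the unit tangent bundle of the surface. -/
def geodesicFlow (t : ℝ) : UTS Γ → UTS Γ :=
  Quotient.map (geodesicFlowH t) (by
    rintro u v ⟨g, rfl⟩
    exact ⟨g, (geodesicFlowH_smul t (g : SL(2, ℝ)) v).symm⟩)

/-- The horocycle flow on the unit tangent bundle of the surface. -/
def horocycleFlow (s : ℝ) : UTS Γ → UTS Γ :=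
  Quotient.map (horocycleFlowH s) (by
    rintro u v ⟨g, rfl⟩
    exact ⟨g, (horocycleFlowH_smul s (g : SL(2, ℝ)) v).symm⟩)

/-- The base point on the surface of a unit tangent vector. -/
def basePoint : UTS Γ → Surface Γ :=
  Quotient.map UTH.base (by
    rintro u v ⟨g, rfl⟩
    exact ⟨g, rfl⟩)

/-- The point at time `t` on the geodesic of the surface with initial vector `u`. -/
def geodesicPoint (u : UTS Γ) (t : ℝ) : Surface Γ := basePoint (geodesicFlow t u)

/-- The distance on the surface: the least distance between lifts. -/
def surfaceDist (x y : Surface Γ) : ℝ :=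
  sInf {r : ℝ | ∃ z w : ℍ, (Quotient.mk _ z : Surface Γ) = x ∧ (Quotient.mk _ w : Surface Γ) = y ∧
    r = dist z w}

/-- The injectivity radius at `x`, in the normalization `inf d(z, g z)` over the elements `g` of
`Γ` other than the identity of the plane, for a lift `z` of `x`. -/
def inj (x : Surface Γ) : ℝ≥0∞ :=
  ⨅ (z : ℍ) (_ : (Quotient.mk _ z : Surface Γ) = x) (g ∈ Γ) (_ : g ≠ 1 ∧ g ≠ -1), edist z (g • z)

/-- The asymptotic thinness of the geodesic half-ray with initial vector `u`. -/
def asymptoticThinness (u : UTS Γ) : ℝ≥0∞ := liminf (fun t : ℝ => inj (geodesicPoint u t)) atTop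

/-- The orbit of `u` under the horocycle flow. -/
def horocycleOrbit (u : UTS Γ) : Set (UTS Γ) := Set.range fun s : ℝ => horocycleFlow s u

variable (Γ) in
/-- The non-wandering set of the horocycle flow. -/
def nonWandering : Set (UTS Γ) :=
  {u | ∀ U ∈ 𝓝 u, ∀ T : ℝ, ∃ s : ℝ, T ≤ s ∧ (horocycleFlow s '' U ∩ U).Nonempty}

/-- The vector `u` is periodic for the horocycle flow. -/
def IsHorocyclePeriodic (u : UTS Γ) : Prop := ∃ s : ℝ, s ≠ 0 ∧ horocycleFlow s u = u

/-- The geodesic half-ray with initial vector `u` is quasi-minimizing. -/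
def IsQuasiMinimizing (u : UTS Γ) : Prop :=
  ∃ C : ℝ, 0 ≤ C ∧ ∀ t : ℝ, 0 < t → t - C ≤ surfaceDist (geodesicPoint u 0) (geodesicPoint u t)

/-- The geodesic half-ray with initial vector `u` is an infinite quasi-minimizing one: it is
quasi-minimizing, and `u` is non-wandering and not periodic for the horocycle flow. -/
def IsInfiniteQuasiMinimizing (u : UTS Γ) : Prop :=
  IsQuasiMinimizing u ∧ u ∈ nonWandering Γ ∧ ¬ IsHorocyclePeriodic u

/-- The set of the times at which the geodesic orbit of `u` meets the closure of its
horocycle orbit. -/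
def recurrenceTimes (u : UTS Γ) : Set ℝ := {t | geodesicFlow t u ∈ closure (horocycleOrbit u)}

end Flute

end

open Flute

noncomputable section

namespace Flute

/-! Let `C_0` be the unit circle and `C_{n+1}` the circle centred on the real axis with endpoints
`16^((2n+1)^2)` and `16^((2n+2)^2)`. The generator `gen n` is the inversion in `C_{n+1}` followed by
the inversion in `C_0`, and `u` is the projection of the upward vector at `i`. The closed discs are
disjoint, so ping-pong controls all reduced words in the inversions; elements of the group are words
of even length.

Geometry of the flute: `p n` is the mirror image of `i` in `C_{n+1}`. The axis of `gen n` is the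
common perpendicular of `C_0` and `C_{n+1}`, so all axes are orthogonal to `C_0`, which therefore
carries all the segments `a_n`: the flute is untwisted.

Dynamics: for a vector `g • upward 0 0`, the first column of `g` up to sign does not change along
the horocycle. The orbit of `u` is thus encoded by the first columns of the group, and `g_t u` by
`(e^(t/2), 0)`. By `word_column` no column is shorter than `(1, 0)`, whence the ray is minimizing.
By `word_rigidity` the upper left entry of a word starting with a far circle is huge or close to `1`
in absolute value: an inversion in `C_{n+1}` hardly changes `|x|` if `(x, y)` points farther out,
and makes it huge if `(x, y)` points nearer in. Hence, in `eq_one_of_column_accumulates`, squared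
columns accumulate on the positive horizontal axis only at `(1, 0)`, so that `T_u = {0}`; since `g_1
u` is non-wandering, the orbit is not dense.

The orbit is not closed because the columns of `gen n` tend to `(0, 1)`, which is not a column of
the group. The vector is non-wandering because the products of the inversions in `C_{n+1}` and
`C_{n+2}` have columns tending to `(1, 0)` and move far along the horocycle. The injectivity radius
tends to infinity by `exists_le_dist_smul_upward`: distinct discs are far apart as soon as one of
them has a large index. -/

/-! ## Inversions in a sequence of disjoint circles -/

/-- A rapidly growing sequence, of the endpoints of the circles. -/
def endpt (k : ℕ) : ℝ := 16 ^ (k ^ 2)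

/-- The centres of the circles; the circle with index `0` is the unit circle. -/
def ctr : ℕ → ℝ
  | 0 => 0
  | n + 1 => (endpt (2 * n + 1) + endpt (2 * n + 2)) / 2

/-- The radii of the circles. -/
def rad : ℕ → ℝ
  | 0 => 1
  | n + 1 => (endpt (2 * n + 2) - endpt (2 * n + 1)) / 2

theorem endpt_pos (k : ℕ) : 0 < endpt k := by unfold endpt; positivity

theorem one_le_endpt (k : ℕ) : 1 ≤ endpt k := one_le_pow₀ (by norm_num)

theorem endpt_strictMono : StrictMono endpt := fun a b h => by
  unfold endpt
  exact pow_lt_pow_right₀ (by norm_num) (Nat.pow_lt_pow_left h (by norm_num))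

/-- Since `16 = 2^4`, this is `b^2 - a^2 ≥ a + b` in the exponents. -/
theorem endpt_mul_le {a b m : ℕ} (hab : a < b) (h : m ≤ 4 * (a + b)) :
    2 ^ m * endpt a ≤ endpt b := by
  unfold endpt
  have : (16 : ℝ) = 2 ^ 4 := by norm_num
  rw [this, ← pow_mul, ← pow_mul, ← pow_add]
  apply pow_le_pow_right₀ (by norm_num)
  nlinarith

theorem rad_pos : ∀ n, 0 < rad n
  | 0 => one_pos
  | n + 1 => by
    have := endpt_strictMono (show 2 * n + 1 < 2 * n + 2 by omega)
    simp only [rad]; linarith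

theorem ctr_add_rad : ∀ n, ctr n + rad n = endpt (2 * n)
  | 0 => by simp [ctr, rad, endpt]
  | n + 1 => by simp only [ctr, rad]; ring_nf

theorem ctr_sub_rad (n : ℕ) : ctr (n + 1) - rad (n + 1) = endpt (2 * n + 1) := by
  simp only [ctr, rad]; ring

theorem ctr_succ_pos (n : ℕ) : 0 < ctr (n + 1) := by
  have := ctr_sub_rad n
  linarith [rad_pos (n + 1), endpt_pos (2 * n + 1)]

theorem ctr_add_rad_lt {a b : ℕ} (h : a < b) : ctr a + rad a < ctr b - rad b := by
  obtain ⟨b, rfl⟩ : ∃ k, b = k + 1 := ⟨b - 1, by omega⟩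
  rw [ctr_add_rad, ctr_sub_rad]
  exact endpt_strictMono (by omega)

/-- The point `i` is never inside a circle; it lies on the unit circle, where the value is `0`. -/
theorem ctr_sq_sub_rad_sq_add_one_nonneg : ∀ n, 0 ≤ ctr n ^ 2 - rad n ^ 2 + 1
  | 0 => by simp [ctr, rad]
  | n + 1 => by
    have h1 := ctr_sub_rad n
    have h2 := ctr_add_rad (n + 1)
    have := mul_pos (endpt_pos (2 * n + 1)) (endpt_pos (2 * (n + 1)))
    rw [← h1, ← h2] at this
    nlinarith

/-- The inversion in the circle with centre `c` and radius `r`, as a matrix. -/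
def inversion (c r : ℝ) (hr : r ≠ 0) : GL (Fin 2) ℝ :=
  .mkOfDetNeZero !![c / r, (r ^ 2 - c ^ 2) / r; 1 / r, -c / r] (by
    rw [Matrix.det_fin_two_of]
    have : c / r * (-c / r) - (r ^ 2 - c ^ 2) / r * (1 / r) = -1 := by field_simp; ring
    rw [this]; norm_num)

/-- The inversions in the circles of the sequence. -/
def refl (n : ℕ) : GL (Fin 2) ℝ := inversion (ctr n) (rad n) (rad_pos n).ne'

theorem val_refl (n : ℕ) : (refl n).val =
    !![ctr n / rad n, (rad n ^ 2 - ctr n ^ 2) / rad n; 1 / rad n, -ctr n / rad n] := rfl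

theorem refl_mul_zero (n : ℕ) (g : GL (Fin 2) ℝ) (j : Fin 2) :
    (refl n * g) 0 j = (ctr n * g 0 j - (ctr n ^ 2 - rad n ^ 2) * g 1 j) / rad n := by
  rw [Units.val_mul, Matrix.mul_apply, Fin.sum_univ_two, val_refl]
  simp
  ring

theorem refl_mul_one (n : ℕ) (g : GL (Fin 2) ℝ) (j : Fin 2) :
    (refl n * g) 1 j = (g 0 j - ctr n * g 1 j) / rad n := by
  rw [Units.val_mul, Matrix.mul_apply, Fin.sum_univ_two, val_refl]
  simp
  ring

theorem refl_mul_self (n : ℕ) : refl n * refl n = 1 := by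
  have h := (rad_pos n).ne'
  ext i j
  fin_cases i
  · change (refl n * refl n) 0 j = _
    rw [refl_mul_zero, val_refl]
    fin_cases j <;> simp [h] <;> field_simp <;> ring
  · change (refl n * refl n) 1 j = _
    rw [refl_mul_one, val_refl]
    fin_cases j <;> simp [h] <;> field_simp <;> ring

theorem det_refl (n : ℕ) : (refl n).val.det = -1 := by
  have h := (rad_pos n).ne'
  rw [val_refl, Matrix.det_fin_two_of]
  field_simp
  ring

theorem refl_inv (n : ℕ) : (refl n)⁻¹ = refl n := inv_eq_of_mul_eq_one_left (refl_mul_self n)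

/-- The generators of the group of the flute. -/
def gen (n : ℕ) : SL(2, ℝ) :=
  ⟨!![1 / rad (n + 1), -ctr (n + 1) / rad (n + 1);
      ctr (n + 1) / rad (n + 1), (rad (n + 1) ^ 2 - ctr (n + 1) ^ 2) / rad (n + 1)], by
    have h := (rad_pos (n + 1)).ne'
    rw [Matrix.det_fin_two_of]
    field_simp
    ring⟩

theorem coe_gen (n : ℕ) : (gen n : GL (Fin 2) ℝ) = refl 0 * refl (n + 1) := by
  ext i j
  fin_cases i
  · change (gen n).1 0 j = (refl 0 * refl (n + 1)) 0 j
    rw [refl_mul_zero, val_refl]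
    fin_cases j <;> simp [gen, ctr, rad]
  · change (gen n).1 1 j = (refl 0 * refl (n + 1)) 1 j
    rw [refl_mul_one, val_refl]
    fin_cases j <;> simp [gen, ctr, rad]

/-! ## Reduced words in the inversions -/

/-- The product of the inversions in a list. -/
def word (l : List ℕ) : GL (Fin 2) ℝ := (l.map refl).prod

@[simp] theorem word_nil : word [] = 1 := rfl

@[simp] theorem word_cons (a : ℕ) (l : List ℕ) : word (a :: l) = refl a * word l := by simp [word]

theorem word_append (l m : List ℕ) : word (l ++ m) = word l * word m := by simp [word]

theorem word_reverse (l : List ℕ) : word l.reverse = (word l)⁻¹ := by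
  induction l with
  | nil => simp
  | cons a l ih => simp [word_append, ih, refl_inv]

theorem exists_reduced (l : List ℕ) : ∃ m : List ℕ, m.IsChain (· ≠ ·) ∧ word m = word l := by
  induction l with
  | nil => exact ⟨[], by simp, rfl⟩
  | cons a l ih =>
    obtain ⟨m, hm, e⟩ := ih
    rw [word_cons, ← e]
    cases m with
    | nil => exact ⟨[a], by simp, by simp⟩
    | cons b m =>
      by_cases hab : a = b
      · subst hab
        exact ⟨m, hm.tail, by rw [word_cons, ← mul_assoc, refl_mul_self, one_mul]⟩
      · exact ⟨a :: b :: m, by simp [hab, hm], by simp⟩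

theorem exists_word {g : SL(2, ℝ)} (hg : g ∈ groupOf gen) :
    ∃ l : List ℕ, l.IsChain (· ≠ ·) ∧ (g : GL (Fin 2) ℝ) = word l := by
  suffices H : ∃ l : List ℕ, (g : GL (Fin 2) ℝ) = word l by
    obtain ⟨l, hl⟩ := H
    obtain ⟨m, hm, e⟩ := exists_reduced l
    exact ⟨m, hm, hl.trans e.symm⟩
  induction hg using Subgroup.closure_induction with
  | mem x hx =>
    obtain ⟨n, rfl⟩ := hx
    exact ⟨[0, n + 1], by simp [coe_gen]⟩
  | one => exact ⟨[], by simp⟩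
  | mul x y _ _ hx hy =>
    obtain ⟨l, hl⟩ := hx
    obtain ⟨m, hm⟩ := hy
    exact ⟨l ++ m, by rw [word_append, ← hl, ← hm, map_mul]⟩
  | inv x _ hx =>
    obtain ⟨l, hl⟩ := hx
    exact ⟨l.reverse, by rw [word_reverse, ← hl, map_inv]⟩

/-! ### Ping-pong on the first columns of words. -/

/-- A quadratic form that is not positive on the vectors whose direction lies between the
endpoints of a circle. -/
def circleForm (n : ℕ) (x y : ℝ) : ℝ := (x - ctr n * y) ^ 2 - rad n ^ 2 * y ^ 2

/-- The form is a product of two linear factors vanishing at the endpoints of the circle, and the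
intervals cut out by distinct circles are disjoint. -/
theorem circleForm_nonneg {a b : ℕ} (hab : a ≠ b) {x y : ℝ} (h : circleForm b x y ≤ 0) :
    0 ≤ circleForm a x y := by
  have e : ∀ n, circleForm n x y =
      (x - (ctr n - rad n) * y) * (x - (ctr n + rad n) * y) := fun n => by
    unfold circleForm; ring
  have ha := rad_pos a
  have hb := rad_pos b
  rw [e] at h ⊢
  -- Multiplication by the sign of `y` replaces the vector by the representative of its direction in
  -- the upper half of the plane.
  have key : (ctr b - rad b) * |y| ≤ SignType.sign y * x ∧
      SignType.sign y * x ≤ (ctr b + rad b) * |y| := by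
    rcases lt_trichotomy y 0 with hy | rfl | hy
    · rw [abs_of_neg hy, sign_neg hy]
      simp only [SignType.coe_neg, SignType.coe_one]
      have : 0 < rad b * -y := by nlinarith
      constructor <;> by_contra hc <;> nlinarith
    · simp
    · rw [abs_of_pos hy, sign_pos hy]
      simp only [SignType.coe_one]
      have : 0 < rad b * y := by nlinarith
      constructor <;> by_contra hc <;> nlinarith
  rcases lt_trichotomy y 0 with hy | rfl | hy
  · rw [abs_of_neg hy, sign_neg hy] at key
    simp only [SignType.coe_neg, SignType.coe_one] at key
    rcases hab.lt_or_gt with hlt | hlt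
    · have := ctr_add_rad_lt hlt
      exact mul_nonneg_of_nonpos_of_nonpos (by nlinarith) (by nlinarith)
    · have := ctr_add_rad_lt hlt
      exact mul_nonneg (by nlinarith) (by nlinarith)
  · simpa using mul_self_nonneg x
  · rw [abs_of_pos hy, sign_pos hy] at key
    simp only [SignType.coe_one] at key
    rcases hab.lt_or_gt with hlt | hlt
    · have := ctr_add_rad_lt hlt
      exact mul_nonneg (by nlinarith) (by nlinarith)
    · have := ctr_add_rad_lt hlt
      exact mul_nonneg_of_nonpos_of_nonpos (by nlinarith) (by nlinarith)

/-- The first column of a nonempty reduced word points into the circle of the first letter,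
and it is not shorter than the vector `(1, 0)`. -/
theorem word_column (a : ℕ) (l : List ℕ) (h : (a :: l).IsChain (· ≠ ·)) :
    circleForm a (word (a :: l) 0 0) (word (a :: l) 1 0) ≤ 0 ∧
      1 ≤ word (a :: l) 0 0 ^ 2 + word (a :: l) 1 0 ^ 2 := by
  induction l generalizing a with
  | nil =>
    have hr := rad_pos a
    have h1 := ctr_sq_sub_rad_sq_add_one_nonneg a
    rw [word_cons, refl_mul_zero, refl_mul_one]
    simp only [word_nil, Units.val_one, Matrix.one_apply_eq, circleForm]
    rw [Matrix.one_apply_ne (by decide)]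
    constructor
    · have : ((ctr a * 1 - (ctr a ^ 2 - rad a ^ 2) * 0) / rad a -
          ctr a * ((1 - ctr a * 0) / rad a)) ^ 2 -
          rad a ^ 2 * ((1 - ctr a * 0) / rad a) ^ 2 = -1 := by field_simp; ring
      rw [this]; norm_num
    · have : ((ctr a * 1 - (ctr a ^ 2 - rad a ^ 2) * 0) / rad a) ^ 2 +
          ((1 - ctr a * 0) / rad a) ^ 2 = 1 + (ctr a ^ 2 - rad a ^ 2 + 1) / rad a ^ 2 := by
        field_simp; ring
      rw [this]
      have : 0 ≤ (ctr a ^ 2 - rad a ^ 2 + 1) / rad a ^ 2 := by positivity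
      linarith
  | cons b l ih =>
    rw [List.isChain_cons_cons] at h
    obtain ⟨hab, hbl⟩ := h
    obtain ⟨i1, i2⟩ := ih b hbl
    have i3 := circleForm_nonneg hab i1
    have hr := rad_pos a
    have h1 := ctr_sq_sub_rad_sq_add_one_nonneg a
    rw [word_cons a, refl_mul_zero, refl_mul_one]
    set x := word (b :: l) 0 0
    set y := word (b :: l) 1 0
    constructor
    -- The inversion exchanges the inside and the outside of its circle: it negates the form.
    · have : circleForm a ((ctr a * x - (ctr a ^ 2 - rad a ^ 2) * y) / rad a)
          ((x - ctr a * y) / rad a) = -circleForm a x y := by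
        unfold circleForm; field_simp; ring
      rw [this]; linarith
    -- The squared length grows by a multiple of the form, with a nonnegative coefficient because
    -- `i` is not inside the circle.
    · have : ((ctr a * x - (ctr a ^ 2 - rad a ^ 2) * y) / rad a) ^ 2 +
          ((x - ctr a * y) / rad a) ^ 2 = x ^ 2 + y ^ 2 +
            (ctr a ^ 2 - rad a ^ 2 + 1) / rad a ^ 2 * circleForm a x y := by
        unfold circleForm; field_simp; ring
      rw [this]
      have : 0 ≤ (ctr a ^ 2 - rad a ^ 2 + 1) / rad a ^ 2 * circleForm a x y := by positivity
      linarith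

theorem det_word (l : List ℕ) : (word l).val.det = (-1) ^ l.length := by
  induction l with
  | nil => simp
  | cons a l ih => rw [word_cons, Units.val_mul, Matrix.det_mul, ih, det_refl, List.length_cons,
      pow_succ, mul_comm]

theorem abs_le_of_circleForm {n : ℕ} {x y : ℝ} (h : circleForm n x y ≤ 0) :
    |x| ≤ endpt (2 * n) * |y| := by
  rw [← ctr_add_rad]
  unfold circleForm at h
  have hr := rad_pos n
  have h1 : |x - ctr n * y| ≤ rad n * |y| := by
    rw [← abs_of_pos hr, ← abs_mul]
    exact sq_le_sq.mp (by nlinarith)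
  have h2 : 0 ≤ ctr n := by
    cases n with
    | zero => simp [ctr]
    | succ n => exact (ctr_succ_pos n).le
  calc |x| = |(x - ctr n * y) + ctr n * y| := by ring_nf
    _ ≤ |x - ctr n * y| + |ctr n * y| := abs_add_le _ _
    _ ≤ _ := by rw [abs_mul (ctr n), abs_of_nonneg h2]; linarith

theorem le_abs_of_circleForm {n : ℕ} {x y : ℝ} (h : circleForm (n + 1) x y ≤ 0) :
    endpt (2 * n + 1) * |y| ≤ |x| := by
  rw [← ctr_sub_rad]
  unfold circleForm at h
  have hr := rad_pos (n + 1)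
  have h1 : |ctr (n + 1) * y - x| ≤ rad (n + 1) * |y| := by
    rw [← abs_of_pos hr, ← abs_mul]
    exact sq_le_sq.mp (by nlinarith)
  have h2 := ctr_succ_pos n
  have := abs_sub_abs_le_abs_sub (ctr (n + 1) * y) x
  rw [abs_mul, abs_of_pos h2] at this
  linarith

theorem word_lower_left_ne_zero {a : ℕ} {l : List ℕ} (h : (a :: l).IsChain (· ≠ ·)) :
    word (a :: l) 1 0 ≠ 0 := by
  intro h0
  obtain ⟨h1, h2⟩ := word_column a l h
  have := abs_le_of_circleForm h1
  rw [h0, abs_zero, mul_zero] at this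
  rw [h0, abs_nonpos_iff.mp this] at h2
  norm_num at h2

theorem eq_one_of_lower_left_eq_zero {g : SL(2, ℝ)} (hg : g ∈ groupOf gen) (h : g 1 0 = 0) :
    g = 1 := by
  obtain ⟨l, hl, e⟩ := exists_word hg
  have h' : word l 1 0 = 0 := by rw [← e]; exact h
  cases l with
  | nil => exact Matrix.SpecialLinearGroup.toGL_injective (by simpa using e)
  | cons a l => exact absurd h' (word_lower_left_ne_zero hl)

/-- No element carries `∞` to `0`: a word with first letter `n + 1` sends `∞` to a positive number,
and a word with first letter `0` sends it to `0` only if its tail fixes `∞`. -/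
theorem upper_left_ne_zero {g : SL(2, ℝ)} (hg : g ∈ groupOf gen) : g 0 0 ≠ 0 := by
  intro h
  obtain ⟨l, hl, e⟩ := exists_word hg
  have h' : word l 0 0 = 0 := by rw [← e]; exact h
  have hdet : (word l).val.det = 1 := by rw [← e]; exact g.2
  match l, hl with
  | [], _ => simp at h'
  | (n + 1) :: l, hl =>
    obtain ⟨h1, h2⟩ := word_column _ l hl
    have h3 := le_abs_of_circleForm h1
    rw [h', abs_zero] at h3
    have h4 : |word ((n + 1) :: l) 1 0| ≤ 0 := by
      have := endpt_pos (2 * n + 1)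
      by_contra hc
      push Not at hc
      nlinarith
    rw [h', abs_nonpos_iff.mp h4] at h2
    norm_num at h2
  -- The inversion in the unit circle alone does exchange `∞` and `0`, but its determinant is `-1`.
  | [0], _ => rw [det_word] at hdet; norm_num at hdet
  | 0 :: m :: l, hl =>
    rw [word_cons 0, refl_mul_zero] at h'
    simp only [ctr, rad] at h'
    exact word_lower_left_ne_zero hl.tail (by linarith)

theorem one_le_column {g : SL(2, ℝ)} (hg : g ∈ groupOf gen) : 1 ≤ g 0 0 ^ 2 + g 1 0 ^ 2 := by
  obtain ⟨l, hl, e⟩ := exists_word hg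
  have h : 1 ≤ word l 0 0 ^ 2 + word l 1 0 ^ 2 := by
    cases l with
    | nil => simp
    | cons a l => exact (word_column a l hl).2
  rw [← e] at h
  exact h

/-! ### Rigidity of the upper left entries. -/

/-- The fraction is, up to sign, the first coordinate of the image of `(x, y)` under the inversion
in the circle with endpoints `lo` and `hi`. Here `(x, y)` points far inside `lo`, so the term in `y`
dominates; `y` itself is not small since the vector has length at least `1`. -/
theorem two_pow_le_of_abs_le {lo hi B E x y : ℝ} (hE : 1 ≤ E) (h1 : 1 ≤ B)
    (h2 : 4 * E * B ≤ lo) (h3 : lo < hi) (h4 : |x| ≤ B * |y|) (h5 : 1 ≤ x ^ 2 + y ^ 2) :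
    E ≤ |((lo + hi) * x - 2 * (lo * hi) * y) / (hi - lo)| := by
  have hlo : 0 < lo := by nlinarith
  have hy : 1 / 2 ≤ B * |y| := by
    by_contra hc
    push Not at hc
    have a1 : x ^ 2 ≤ (1 / 2) ^ 2 := sq_le_sq' (by linarith [neg_abs_le x]) (by linarith [le_abs_self x])
    have a2 : |y| ≤ 1 / 2 := by nlinarith [abs_nonneg y]
    have a3 : y ^ 2 ≤ (1 / 2) ^ 2 := sq_le_sq' (by linarith [neg_abs_le y]) (by linarith [le_abs_self y])
    linarith
  rw [abs_div, abs_of_pos (sub_pos.mpr h3), le_div_iff₀ (sub_pos.mpr h3)]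
  have a1 := abs_sub_abs_le_abs_sub (2 * (lo * hi) * y) ((lo + hi) * x)
  rw [abs_sub_comm, abs_mul, abs_mul (lo + hi), abs_of_pos (show 0 < lo + hi by linarith),
    abs_of_pos (show 0 < 2 * (lo * hi) by nlinarith)] at a1
  have a2 : (lo + hi) * |x| ≤ (lo + hi) * (B * |y|) :=
    mul_le_mul_of_nonneg_left h4 (by linarith)
  have a3 : 4 * E * (B * |y|) ≤ lo * |y| := by
    have := mul_le_mul_of_nonneg_right h2 (abs_nonneg y)
    linarith
  have a4 : hi * (4 * E * (B * |y|)) ≤ hi * (lo * |y|) :=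
    mul_le_mul_of_nonneg_left a3 (by linarith)
  have a5 : (lo + hi) * (B * |y|) ≤ 2 * hi * (B * |y|) :=
    mul_le_mul_of_nonneg_right (by linarith) (by linarith)
  have a6 : 3 * E ≤ (4 * E - 1) * (2 * (B * |y|)) := by nlinarith
  have a7 : hi * (3 * E) ≤ hi * ((4 * E - 1) * (2 * (B * |y|))) :=
    mul_le_mul_of_nonneg_left a6 (by linarith)
  nlinarith

/-- The opposite regime: `(x, y)` points far beyond `lo`, the term in `y` is negligible, and `(lo +
hi) / (hi - lo)` is close to `1`. -/
theorem abs_close_of_le_abs {lo hi B E x y : ℝ} (hE : 1 ≤ E) (hlo : 0 < lo)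
    (h2 : 64 * E * lo ≤ B) (h3 : 64 * E * lo ≤ hi) (h4 : B * |y| ≤ |x|) :
    |x| * (1 - E⁻¹ / 4) ≤ |((lo + hi) * x - 2 * (lo * hi) * y) / (hi - lo)| ∧
    |((lo + hi) * x - 2 * (lo * hi) * y) / (hi - lo)| ≤ |x| * (1 + E⁻¹ / 4) := by
  have hlt : lo < hi := by nlinarith
  have hpos := sub_pos.mpr hlt
  have e1 : E * E⁻¹ = 1 := mul_inv_cancel₀ (by linarith)
  have e0 : 0 < E⁻¹ := by positivity
  have e2 : lo ≤ hi * (E⁻¹ / 64) := by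
    have := mul_le_mul_of_nonneg_right h3 e0.le
    nlinarith
  have e3 : lo * |y| ≤ |x| * (E⁻¹ / 64) := by
    have a := mul_le_mul_of_nonneg_right h2 (abs_nonneg y)
    have := mul_le_mul_of_nonneg_right (a.trans h4) e0.le
    have e5 : 64 * E * lo * |y| * E⁻¹ = 64 * (lo * |y|) * (E * E⁻¹) := by ring
    rw [e5, e1] at this
    linarith
  have e4 : hi * (lo * |y|) ≤ hi * (|x| * (E⁻¹ / 64)) :=
    mul_le_mul_of_nonneg_left e3 (by linarith)
  have e6 : lo * |x| ≤ hi * (E⁻¹ / 64) * |x| := mul_le_mul_of_nonneg_right e2 (abs_nonneg x)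
  have e7 : 0 ≤ lo * |x| := by positivity
  have e9 : E⁻¹ ≤ 1 := inv_le_one_of_one_le₀ hE
  have e8 : 0 ≤ hi * (E⁻¹ * |x|) := by have := hlo.trans hlt; positivity
  have e10 : 0 ≤ lo * |x| * E⁻¹ := by positivity
  have e11 : lo * |x| * E⁻¹ ≤ lo * |x| := by nlinarith
  rw [abs_div, abs_of_pos hpos]
  have s1 := abs_sub_abs_le_abs_sub ((lo + hi) * x) (2 * (lo * hi) * y)
  have s2 := abs_sub ((lo + hi) * x) (2 * (lo * hi) * y)
  rw [abs_mul (lo + hi), abs_mul (2 * (lo * hi)), abs_of_pos (show 0 < lo + hi by linarith),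
    abs_of_pos (show 0 < 2 * (lo * hi) by nlinarith)] at s1 s2
  constructor
  · rw [le_div_iff₀ hpos]
    nlinarith
  · rw [div_le_iff₀ hpos]
    nlinarith

/-- The first coordinate of the first column of a reduced word which starts with a letter of
high index is either large or close to `1` in absolute value. -/
theorem word_rigidity (n : ℕ) (l : List ℕ) (h : ((n + 1) :: l).IsChain (· ≠ ·)) :
    2 ^ (n + 1) ≤ |word ((n + 1) :: l) 0 0| ∨
      |(|word ((n + 1) :: l) 0 0| - 1)| ≤ (2 ^ (n + 1))⁻¹ := by
  have hE : (2 : ℝ) ≤ 2 ^ (n + 1) := by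
    rw [pow_succ]; linarith [one_le_pow₀ (show (1 : ℝ) ≤ 2 by norm_num) (n := n)]
  have hlo := endpt_pos (2 * n + 1)
  have hhi : 64 * 2 ^ (n + 1) * endpt (2 * n + 1) ≤ endpt (2 * n + 2) := by
    have := endpt_mul_le (show 2 * n + 1 < 2 * n + 2 by omega)
      (show n + 1 + 6 ≤ 4 * (2 * n + 1 + (2 * n + 2)) by omega)
    rw [pow_add] at this
    linarith
  have form : word ((n + 1) :: l) 0 0 =
      ((endpt (2 * n + 1) + endpt (2 * n + 2)) * word l 0 0 -
        2 * (endpt (2 * n + 1) * endpt (2 * n + 2)) * word l 1 0) /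
        (endpt (2 * n + 2) - endpt (2 * n + 1)) := by
    have := endpt_strictMono (show 2 * n + 1 < 2 * n + 2 by omega)
    have := (sub_pos.mpr this).ne'
    rw [word_cons, refl_mul_zero]
    simp only [ctr, rad]
    field_simp
    ring
  induction l generalizing n with
  | nil =>
    right
    rw [form]
    -- The empty word has column `(1, 0)`, so any bound `B` is admissible; `le_rfl` selects the
    -- least one.
    obtain ⟨s1, s2⟩ := abs_close_of_le_abs (x := word [] 0 0) (y := word [] 1 0)
      (show (1 : ℝ) ≤ 2 ^ (n + 1) by linarith) hlo le_rfl hhi (by simp)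
    simp only [word_nil, Units.val_one, Matrix.one_apply_eq, abs_one, one_mul] at s1 s2 ⊢
    have : (0 : ℝ) < (2 ^ (n + 1))⁻¹ := by positivity
    rw [abs_le]
    constructor <;> linarith
  | cons b l ih =>
    rw [List.isChain_cons_cons] at h
    obtain ⟨hab, hbl⟩ := h
    obtain ⟨c1, c2⟩ := word_column b l hbl
    rw [form]
    -- If the next circle is farther out, induction applies to the tail: its error is at most half
    -- of the admissible one, and the inversion adds a relative error of a quarter. If the next
    -- circle is nearer, the entry is large at once.
    rcases hab.lt_or_gt with hlt | hlt
    · obtain ⟨b, rfl⟩ : ∃ k, b = k + 1 := ⟨b - 1, by omega⟩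
      have hlob := endpt_pos (2 * b + 1)
      have hlob' : 64 * 2 ^ (n + 1) * endpt (2 * n + 1) ≤ endpt (2 * b + 1) := by
        have := endpt_mul_le (show 2 * n + 1 < 2 * b + 1 by omega)
          (show n + 1 + 6 ≤ 4 * (2 * n + 1 + (2 * b + 1)) by omega)
        rw [pow_add] at this
        linarith
      obtain ⟨s1, s2⟩ := abs_close_of_le_abs (show (1 : ℝ) ≤ 2 ^ (n + 1) by linarith) hlo hlob' hhi
        (le_abs_of_circleForm c1)
      have hpow : (2 : ℝ) * 2 ^ (n + 1) ≤ 2 ^ (b + 1) := by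
        rw [← pow_succ']
        exact pow_le_pow_right₀ (by norm_num) (by omega)
      have hpos : (0 : ℝ) < 2 ^ (n + 1) := by positivity
      have hinv : ((2 : ℝ) ^ (b + 1))⁻¹ ≤ (2 ^ (n + 1))⁻¹ / 2 := by
        rw [inv_le_comm₀ (by positivity) (by positivity)]
        field_simp
        linarith
      have hE1 : ((2 : ℝ) ^ (n + 1))⁻¹ ≤ 1 / 2 := by
        rw [inv_le_comm₀ hpos (by norm_num)]; linarith
      have hE0 : (0 : ℝ) < (2 ^ (n + 1))⁻¹ := by positivity
      have hrec := ih b hbl (by linarith) hlob (by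
          have := endpt_mul_le (show 2 * b + 1 < 2 * b + 2 by omega)
            (show b + 1 + 6 ≤ 4 * (2 * b + 1 + (2 * b + 2)) by omega)
          rw [pow_add] at this
          linarith) (by
        have := endpt_strictMono (show 2 * b + 1 < 2 * b + 2 by omega)
        have := (sub_pos.mpr this).ne'
        rw [word_cons, refl_mul_zero]
        simp only [ctr, rad]
        field_simp
        ring)
      rcases hrec with hr | hr
      · left
        nlinarith
      · right
        rw [abs_le] at hr ⊢
        constructor <;> nlinarith
    · left
      have hB : 4 * 2 ^ (n + 1) * endpt (2 * b) ≤ endpt (2 * n + 1) := by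
        have := endpt_mul_le (show 2 * n < 2 * n + 1 by omega)
          (show n + 1 + 2 ≤ 4 * (2 * n + (2 * n + 1)) by omega)
        have h2 : endpt (2 * b) ≤ endpt (2 * n) := endpt_strictMono.monotone (by omega)
        rw [pow_add] at this
        have h3 : (0 : ℝ) < 2 ^ (n + 1) := by positivity
        nlinarith
      exact two_pow_le_of_abs_le (by linarith) (one_le_endpt _) hB
        (endpt_strictMono (by omega)) (abs_le_of_circleForm c1) c2

/-- The only accumulation point of the squares of the first columns of the group on the positive
horizontal axis is `(1, 0)`. -/
theorem eq_one_of_column_accumulates {s : ℝ}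
    (h : ∀ δ > 0, ∃ g ∈ groupOf gen, |g 0 0 ^ 2 - s| < δ ∧ g 1 0 ^ 2 < δ) : s = 1 := by
  by_contra hs
  have hs' : 0 < |s - 1| := abs_pos.mpr (sub_ne_zero.mpr hs)
  -- This `N` makes the large alternative of `word_rigidity` exceed `|s| + 1`, and the other one
  -- yield `|x^2 - 1| ≤ |s - 1| / 2`.
  obtain ⟨N, hN⟩ : ∃ N : ℕ, |s| + 1 + 6 / |s - 1| < 2 ^ N :=
    pow_unbounded_of_one_lt _ (by norm_num)
  have hq : 0 < 6 / |s - 1| := by positivity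
  have hH := endpt_pos (2 * N)
  set H := endpt (2 * N)
  -- The bound `1 / 2` excludes the first letter `0`, `1 / (2 * H ^ 2)` the other first letters up
  -- to `N`, and `|s - 1| / 2` the empty word; it also closes the final triangle inequality.
  obtain ⟨g, hg, g1, g2⟩ := h (min (min (1 / 2) (|s - 1| / 2)) (1 / (2 * H ^ 2))) (by positivity)
  simp only [lt_min_iff] at g1 g2
  obtain ⟨⟨g1, g1'⟩, -⟩ := g1
  obtain ⟨⟨g2, -⟩, g2'⟩ := g2
  obtain ⟨l, hl, e⟩ := exists_word hg
  have e00 : g 0 0 = word l 0 0 := by rw [← e]; rfl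
  have e10 : g 1 0 = word l 1 0 := by rw [← e]; rfl
  rw [e00] at g1 g1'
  rw [e10] at g2 g2'
  match l, hl with
  | [], _ =>
    simp only [word_nil, Units.val_one, Matrix.one_apply_eq, one_pow] at g1'
    rw [abs_sub_comm] at g1'
    linarith
  | 0 :: l, hl =>
    obtain ⟨h1, h2⟩ := word_column 0 l hl
    simp only [circleForm, ctr, rad] at h1
    linarith
  | (n + 1) :: l, hl =>
    obtain ⟨h1, h2⟩ := word_column _ l hl
    have h3 := abs_le_of_circleForm h1
    have h4 := word_rigidity n l hl
    set x := word ((n + 1) :: l) 0 0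
    set y := word ((n + 1) :: l) 1 0
    have hnN : N < n + 1 := by
      by_contra hc
      have a1 : endpt (2 * (n + 1)) ≤ H := endpt_strictMono.monotone (by omega)
      have a2 : |x| ≤ H * |y| := h3.trans (mul_le_mul_of_nonneg_right a1 (abs_nonneg y))
      have a3 : x ^ 2 ≤ H ^ 2 * y ^ 2 := by
        rw [← sq_abs x, ← sq_abs y, ← mul_pow]
        exact pow_le_pow_left₀ (abs_nonneg x) a2 2
      rw [lt_div_iff₀ (by positivity)] at g2'
      nlinarith
    have hpow : (2 : ℝ) ^ N ≤ 2 ^ (n + 1) := pow_le_pow_right₀ (by norm_num) hnN.le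
    have hx : x ^ 2 < |s| + 1 := by
      linarith [le_abs_self (x ^ 2 - s), le_abs_self s]
    have h2N : (1 : ℝ) ≤ 2 ^ N := one_le_pow₀ (by norm_num)
    rcases h4 with h4 | h4
    · have : 2 ^ N ≤ |x| := hpow.trans h4
      rw [← sq_abs] at hx
      nlinarith
    · have hinv : ((2 : ℝ) ^ (n + 1))⁻¹ ≤ |s - 1| / 6 := by
        rw [inv_le_comm₀ (by positivity) (by positivity), inv_div]
        linarith [abs_nonneg s]
      have hinv1 : ((2 : ℝ) ^ (n + 1))⁻¹ ≤ 1 :=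
        inv_le_one_of_one_le₀ (h2N.trans hpow)
      have hx2 : |x ^ 2 - 1| ≤ |s - 1| / 2 := by
        rw [← sq_abs x, show |x| ^ 2 - 1 = (|x| - 1) * (|x| + 1) by ring, abs_mul]
        have b1 : |(|x| + 1)| ≤ 3 := by
          rw [abs_of_nonneg (by positivity)]
          linarith [le_abs_self (|x| - 1)]
        calc _ ≤ |s - 1| / 6 * 3 := mul_le_mul (h4.trans hinv) b1 (abs_nonneg _) (by positivity)
          _ = _ := by ring
      have := abs_sub_le s (x ^ 2) 1
      rw [abs_sub_comm s (x ^ 2)] at this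
      linarith

/-! ## The action of the inversions on the plane -/

/-- The squared distance to the centre of a circle. -/
def centreDistSq (n : ℕ) (z : ℍ) : ℝ := (z.re - ctr n) ^ 2 + z.im ^ 2

theorem centreDistSq_pos (n : ℕ) (z : ℍ) : 0 < centreDistSq n z := by
  have := z.im_pos
  unfold centreDistSq; positivity

theorem coe_refl_smul (n : ℕ) (z : ℍ) : ((refl n • z : ℍ) : ℂ) =
    ⟨ctr n + rad n ^ 2 * (z.re - ctr n) / centreDistSq n z, rad n ^ 2 * z.im / centreDistSq n z⟩ := by
  have hr := (rad_pos n).ne'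
  have hN := centreDistSq_pos n z
  have hden : denom (refl n) z = ((1 / rad n : ℝ) : ℂ) * z + (-ctr n / rad n : ℝ) := by
    simp [denom, val_refl]
  have hnum : num (refl n) z = ((ctr n / rad n : ℝ) : ℂ) * z +
      ((rad n ^ 2 - ctr n ^ 2) / rad n : ℝ) := by
    simp [num, val_refl]
  have hne := denom_ne_zero (refl n) z
  -- A matrix of negative determinant acts on `ℍ` through complex conjugation, which turns the
  -- Möbius map of `refl n` into the inversion.
  have hdet : ¬ 0 < (refl n).det.val := by
    rw [Matrix.GeneralLinearGroup.val_det_apply, det_refl]; norm_num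
  have e : num (refl n) z / denom (refl n) z =
      ⟨ctr n + rad n ^ 2 * (z.re - ctr n) / centreDistSq n z,
        -(rad n ^ 2 * z.im / centreDistSq n z)⟩ := by
    rw [div_eq_iff hne, hnum, hden]
    unfold centreDistSq at hN ⊢
    apply Complex.ext
    · simp only [Complex.add_re, Complex.mul_re, Complex.ofReal_re, Complex.ofReal_im,
        UpperHalfPlane.coe_re, UpperHalfPlane.coe_im, Complex.add_im, Complex.mul_im]
      field_simp
      ring
    · simp only [Complex.add_re, Complex.mul_re, Complex.ofReal_re, Complex.ofReal_im,
        UpperHalfPlane.coe_re, UpperHalfPlane.coe_im, Complex.add_im, Complex.mul_im]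
      field_simp
      ring
  rw [coe_smul, e, σ, if_neg hdet]
  apply Complex.ext <;> simp

theorem re_refl_smul (n : ℕ) (z : ℍ) :
    (refl n • z : ℍ).re = ctr n + rad n ^ 2 * (z.re - ctr n) / centreDistSq n z := by
  rw [← UpperHalfPlane.coe_re, coe_refl_smul]

theorem im_refl_smul (n : ℕ) (z : ℍ) :
    (refl n • z : ℍ).im = rad n ^ 2 * z.im / centreDistSq n z := by
  rw [← UpperHalfPlane.coe_im, coe_refl_smul]

theorem centreDistSq_refl_smul (n : ℕ) (z : ℍ) :
    centreDistSq n (refl n • z) = rad n ^ 4 / centreDistSq n z := by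
  have h := centreDistSq_pos n z
  have : centreDistSq n z = (z.re - ctr n) ^ 2 + z.im ^ 2 := rfl
  rw [centreDistSq, re_refl_smul, im_refl_smul]
  field_simp
  rw [this]
  ring

theorem dist_coe_sq (z w : ℍ) :
    dist (z : ℂ) w ^ 2 = (z.re - w.re) ^ 2 + (z.im - w.im) ^ 2 := by
  rw [Complex.dist_eq, ← Complex.normSq_eq_norm_sq, Complex.normSq_apply]
  simp
  ring

theorem cosh_dist_eq (z w : ℍ) : Real.cosh (dist z w) =
    1 + ((z.re - w.re) ^ 2 + (z.im - w.im) ^ 2) / (2 * z.im * w.im) := by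
  rw [UpperHalfPlane.cosh_dist, dist_coe_sq]

theorem dist_le_dist_iff (z w z' w' : ℍ) :
    dist z w ≤ dist z' w' ↔ Real.cosh (dist z w) ≤ Real.cosh (dist z' w') := by
  rw [Real.cosh_le_cosh, abs_of_nonneg dist_nonneg, abs_of_nonneg dist_nonneg]

theorem isometry_refl (n : ℕ) : Isometry fun z : ℍ => refl n • z := by
  refine Isometry.of_dist_eq fun z w => ?_
  have hz := centreDistSq_pos n z
  have hw := centreDistSq_pos n w
  have hz' := z.im_pos
  have hw' := w.im_pos
  have hr := rad_pos n
  have key : Real.cosh (dist (refl n • z) (refl n • w)) = Real.cosh (dist z w) := by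
    rw [cosh_dist_eq, cosh_dist_eq, re_refl_smul, re_refl_smul, im_refl_smul, im_refl_smul]
    unfold centreDistSq at *
    field_simp
    ring
  exact le_antisymm ((dist_le_dist_iff _ _ _ _).mpr key.le) ((dist_le_dist_iff _ _ _ _).mpr key.ge)

theorem dist_refl_smul (n : ℕ) (z w : ℍ) : dist (refl n • z) (refl n • w) = dist z w :=
  (isometry_refl n).dist_eq z w

theorem refl_smul_smul (n : ℕ) (z : ℍ) : refl n • refl n • z = z := by
  rw [smul_smul, refl_mul_self, one_smul]

/-- The inversions as isometries of the plane. -/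
def reflIsometry (n : ℕ) : ℍ ≃ᵢ ℍ where
  toEquiv := MulAction.toPerm (refl n)
  isometry_toFun := isometry_refl n

theorem refl_smul_eq_iff (n : ℕ) (z : ℍ) : refl n • z = z ↔ centreDistSq n z = rad n ^ 2 := by
  have h := centreDistSq_pos n z
  have hr := rad_pos n
  constructor
  · intro e
    have e2 := congrArg UpperHalfPlane.im e
    rw [im_refl_smul, div_eq_iff h.ne', mul_comm] at e2
    exact (mul_left_cancel₀ z.im_pos.ne' e2).symm
  · intro e
    apply UpperHalfPlane.ext
    rw [coe_refl_smul, e]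
    have := hr.ne'
    apply Complex.ext
    · simp
      field_simp
      simp
    · simp
      field_simp

theorem centreDistSq_zero (z : ℍ) : centreDistSq 0 z = ‖(z : ℂ)‖ ^ 2 := by
  rw [← Complex.normSq_eq_norm_sq, Complex.normSq_apply]
  simp [centreDistSq, ctr]
  ring

theorem isReflection_refl_zero : IsReflection {z : ℍ | ‖(z : ℂ)‖ = 1} (reflIsometry 0) := by
  ext z
  change refl 0 • z = z ↔ ‖(z : ℂ)‖ = 1
  rw [refl_smul_eq_iff, centreDistSq_zero]
  simp only [rad]
  rw [one_pow]
  exact pow_eq_one_iff_of_nonneg (norm_nonneg _) two_ne_zero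

theorem norm_refl_zero_smul (z : ℍ) : ‖((refl 0 • z : ℍ) : ℂ)‖ = ‖(z : ℂ)‖⁻¹ := by
  have h := centreDistSq_refl_smul 0 z
  rw [centreDistSq_zero, centreDistSq_zero] at h
  simp only [rad, one_pow, one_div, ← inv_pow] at h
  exact (pow_left_inj₀ (norm_nonneg _) (inv_nonneg.mpr (norm_nonneg _)) two_ne_zero).mp h

theorem refl_zero_smul_I : refl 0 • (I : ℍ) = I := by
  rw [refl_smul_eq_iff, centreDistSq_zero]
  simp [rad]

/-- Comparison of the distances from `z` to `i` and to its image under an inversion. -/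
theorem cosh_dist_sub (n : ℕ) (z : ℍ) :
    Real.cosh (dist z (refl n • I)) - Real.cosh (dist z I) =
      (ctr n ^ 2 - rad n ^ 2 + 1) / (2 * z.im * rad n ^ 2) * (centreDistSq n z - rad n ^ 2) := by
  have hz' := z.im_pos
  have hr := rad_pos n
  have hN : 0 < (0 - ctr n) ^ 2 + (1 : ℝ) ^ 2 := by positivity
  rw [cosh_dist_eq, cosh_dist_eq, re_refl_smul, im_refl_smul]
  unfold centreDistSq
  simp only [UpperHalfPlane.I_re, UpperHalfPlane.I_im]
  field_simp
  ring

theorem closedHalfPlane_refl (n : ℕ) :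
    closedHalfPlane (refl (n + 1) • I) I = {z | centreDistSq (n + 1) z ≤ rad (n + 1) ^ 2} := by
  ext z
  change dist z _ ≤ dist z _ ↔ centreDistSq _ _ ≤ _
  rw [dist_le_dist_iff, ← sub_nonpos, cosh_dist_sub]
  have h : 0 < (ctr (n + 1) ^ 2 - rad (n + 1) ^ 2 + 1) / (2 * z.im * rad (n + 1) ^ 2) := by
    have h1 := ctr_sub_rad n
    have := endpt_pos (2 * n + 1)
    have := rad_pos (n + 1)
    have := z.im_pos
    have : 0 < ctr (n + 1) ^ 2 - rad (n + 1) ^ 2 := by nlinarith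
    positivity
  rw [mul_nonpos_iff_pos_imp_nonpos]
  constructor
  · rintro ⟨h1, -⟩; linarith [h1 h]
  · intro h2
    exact ⟨fun _ => by linarith, fun h3 => h.le⟩

theorem bisector_refl (n : ℕ) :
    bisector I (refl (n + 1) • I) = {z | centreDistSq (n + 1) z = rad (n + 1) ^ 2} := by
  ext z
  change dist z _ = dist z _ ↔ centreDistSq _ _ = _
  have h : 0 < (ctr (n + 1) ^ 2 - rad (n + 1) ^ 2 + 1) / (2 * z.im * rad (n + 1) ^ 2) := by
    have h1 := ctr_sub_rad n
    have := endpt_pos (2 * n + 1)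
    have := rad_pos (n + 1)
    have := z.im_pos
    have : 0 < ctr (n + 1) ^ 2 - rad (n + 1) ^ 2 := by nlinarith
    positivity
  have h2 := cosh_dist_sub (n + 1) z
  constructor
  · intro e
    rw [e, sub_self] at h2
    rcases mul_eq_zero.mp h2.symm with h3 | h3
    · exact absurd h3 h.ne'
    · linarith
  · intro e
    rw [e, sub_self, mul_zero] at h2
    exact le_antisymm ((dist_le_dist_iff _ _ _ _).mpr (by linarith))
      ((dist_le_dist_iff _ _ _ _).mpr (by linarith))

theorem isReflection_refl (n : ℕ) :
    IsReflection (bisector I (refl (n + 1) • I)) (reflIsometry (n + 1)) := by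
  rw [bisector_refl]
  ext z
  exact refl_smul_eq_iff _ z

theorem gen_smul (n : ℕ) (z : ℍ) : gen n • z = refl 0 • refl (n + 1) • z := by
  rw [smul_smul, ← coe_gen]
  rfl

theorem gen_inv_smul (n : ℕ) (z : ℍ) : (gen n)⁻¹ • z = refl (n + 1) • refl 0 • z := by
  rw [inv_smul_eq_iff, gen_smul, refl_smul_smul, refl_smul_smul]

/-! ## The logarithm of the Euclidean norm -/

/-- The hyperbolic cosine of the left side is `1 + (|z| - |w|)^2 / (2 |z| |w|)`, which is compared
factor by factor with the formula for the distance. Disjoint annuli about `0` are thereby at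
positive distance. -/
theorem log_norm_sub_le_dist (z w : ℍ) :
    Real.log ‖(z : ℂ)‖ - Real.log ‖(w : ℂ)‖ ≤ dist z w := by
  have hz : 0 < ‖(z : ℂ)‖ := norm_pos_iff.mpr z.ne_zero
  have hw : 0 < ‖(w : ℂ)‖ := norm_pos_iff.mpr w.ne_zero
  have key : Real.cosh (Real.log ‖(z : ℂ)‖ - Real.log ‖(w : ℂ)‖) ≤ Real.cosh (dist z w) := by
    rw [← Real.log_div hz.ne' hw.ne', Real.cosh_log (by positivity), UpperHalfPlane.cosh_dist]
    have h1 : (‖(z : ℂ)‖ - ‖(w : ℂ)‖) ^ 2 ≤ dist (z : ℂ) w ^ 2 := by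
      rw [Complex.dist_eq, ← sq_abs]
      exact pow_le_pow_left₀ (abs_nonneg _) (abs_norm_sub_norm_le _ _) 2
    have h2 : z.im * w.im ≤ ‖(z : ℂ)‖ * ‖(w : ℂ)‖ := by
      refine mul_le_mul ?_ ?_ w.im_pos.le hz.le
      · exact (le_abs_self _).trans (Complex.abs_im_le_norm (z : ℂ))
      · exact (le_abs_self _).trans (Complex.abs_im_le_norm (w : ℂ))
    have e : (‖(z : ℂ)‖ / ‖(w : ℂ)‖ + (‖(z : ℂ)‖ / ‖(w : ℂ)‖)⁻¹) / 2 =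
        1 + (‖(z : ℂ)‖ - ‖(w : ℂ)‖) ^ 2 / (2 * (‖(z : ℂ)‖ * ‖(w : ℂ)‖)) := by
      field_simp; ring
    rw [e]
    have h3 := z.im_pos
    have h4 := w.im_pos
    have h5 : (‖(z : ℂ)‖ - ‖(w : ℂ)‖) ^ 2 / (2 * (‖(z : ℂ)‖ * ‖(w : ℂ)‖)) ≤
        dist (z : ℂ) w ^ 2 / (2 * z.im * w.im) := by
      apply div_le_div₀ (by positivity) h1 (by positivity)
      linarith
    linarith
  rw [Real.cosh_le_cosh, abs_of_nonneg dist_nonneg] at key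
  exact (le_abs_self _).trans key

theorem areSeparated_of_norm {s t : Set ℍ} {a b : ℝ} (ha : 0 < a) (hab : a < b)
    (hs : ∀ z ∈ s, ‖(z : ℂ)‖ ≤ a) (ht : ∀ z ∈ t, b ≤ ‖(z : ℂ)‖) : Metric.AreSeparated s t := by
  refine ⟨ENNReal.ofReal (Real.log b - Real.log a), ?_, fun x hx y hy => ?_⟩
  · rw [ENNReal.ofReal_ne_zero_iff, sub_pos]
    exact Real.log_lt_log ha hab
  · rw [edist_dist]
    apply ENNReal.ofReal_le_ofReal
    have h1 := log_norm_sub_le_dist y x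
    have h2 := Real.log_le_log (ha.trans hab) (ht y hy)
    have h3 := Real.log_le_log (norm_pos_iff.mpr x.ne_zero) (hs x hx)
    rw [dist_comm]
    linarith

theorem norm_le_of_centreDistSq_le {n : ℕ} {z : ℍ} (h : centreDistSq n z ≤ rad n ^ 2) :
    ‖(z : ℂ)‖ ≤ endpt (2 * n) := by
  rw [← ctr_add_rad]
  have hr := rad_pos n
  have h2 : 0 ≤ ctr n := by
    cases n with
    | zero => simp [ctr]
    | succ n => exact (ctr_succ_pos n).le
  have h1 : ‖(z : ℂ) - (ctr n : ℝ)‖ ≤ rad n := by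
    apply le_of_sq_le_sq _ hr.le
    rw [← Complex.normSq_eq_norm_sq, Complex.normSq_apply]
    simp only [Complex.sub_re, Complex.sub_im, Complex.ofReal_re, Complex.ofReal_im,
      UpperHalfPlane.coe_re, UpperHalfPlane.coe_im]
    unfold centreDistSq at h
    linarith
  have := norm_add_le ((z : ℂ) - (ctr n : ℝ)) (ctr n : ℝ)
  rw [sub_add_cancel, Complex.norm_real, Real.norm_eq_abs, abs_of_nonneg h2] at this
  linarith

theorem le_norm_of_centreDistSq_le {n : ℕ} {z : ℍ}
    (h : centreDistSq (n + 1) z ≤ rad (n + 1) ^ 2) : endpt (2 * n + 1) ≤ ‖(z : ℂ)‖ := by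
  rw [← ctr_sub_rad]
  have hr := rad_pos (n + 1)
  have h1 : ‖((ctr (n + 1) : ℝ) : ℂ) - z‖ ≤ rad (n + 1) := by
    apply le_of_sq_le_sq _ hr.le
    rw [← Complex.normSq_eq_norm_sq, Complex.normSq_apply]
    simp only [Complex.sub_re, Complex.sub_im, Complex.ofReal_re, Complex.ofReal_im,
      UpperHalfPlane.coe_re, UpperHalfPlane.coe_im]
    unfold centreDistSq at h
    linarith
  have := norm_add_le (((ctr (n + 1) : ℝ) : ℂ) - z) z
  rw [sub_add_cancel, Complex.norm_real, Real.norm_eq_abs, abs_of_pos (ctr_succ_pos n)] at this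
  linarith

/-! ## The Schottky property -/

/-- Since `i` lies on the unit circle, the inverse of `gen n` carries it to its mirror image in the
circle `n + 1`, and the half-plane is the disc of that circle. The half-plane of `gen n` is the
mirror image of this disc in the unit circle. -/
theorem mem_schottkyHalfPlane_false {n : ℕ} {z : ℍ} (h : z ∈ schottkyHalfPlane gen I (n, false)) :
    endpt (2 * n + 1) ≤ ‖(z : ℂ)‖ ∧ ‖(z : ℂ)‖ ≤ endpt (2 * n + 2) := by
  have h' : z ∈ closedHalfPlane (refl (n + 1) • I) I := by
    rw [← refl_zero_smul_I, ← gen_inv_smul, refl_zero_smul_I]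
    exact h
  rw [closedHalfPlane_refl] at h'
  exact ⟨le_norm_of_centreDistSq_le h', norm_le_of_centreDistSq_le h'⟩

theorem mem_schottkyHalfPlane_true {n : ℕ} {z : ℍ} (h : z ∈ schottkyHalfPlane gen I (n, true)) :
    (endpt (2 * n + 2))⁻¹ ≤ ‖(z : ℂ)‖ ∧ ‖(z : ℂ)‖ ≤ (endpt (2 * n + 1))⁻¹ := by
  have h0 : dist z (refl 0 • refl (n + 1) • I) ≤ dist z I := by
    rw [← gen_smul]; exact h
  have h' : refl 0 • z ∈ closedHalfPlane (refl (n + 1) • I) I := by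
    change dist _ _ ≤ dist _ _
    rw [← dist_refl_smul 0, refl_smul_smul, ← dist_refl_smul 0 (refl 0 • z) I, refl_smul_smul,
      refl_zero_smul_I]
    exact h0
  rw [closedHalfPlane_refl] at h'
  have h1 := le_norm_of_centreDistSq_le h'
  have h2 := norm_le_of_centreDistSq_le h'
  rw [norm_refl_zero_smul] at h1 h2
  have hz : 0 < ‖(z : ℂ)‖ := norm_pos_iff.mpr z.ne_zero
  exact ⟨(inv_le_comm₀ hz (endpt_pos _)).mp h2, (le_inv_comm₀ (endpt_pos _) hz).mp h1⟩

/-- With endpoints `lo < hi`, the trace condition becomes `lo * hi - 1 > hi - lo`, that is `(lo - 1)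
* (hi + 1) > 0`. -/
theorem isHyperbolic_gen (n : ℕ) : Matrix.IsHyperbolic (gen n : Matrix (Fin 2) (Fin 2) ℝ) := by
  have hlt := endpt_strictMono (show 0 < 2 * n + 1 by omega)
  have hr := rad_pos (n + 1)
  have e1 := ctr_sub_rad n
  have e2 := ctr_add_rad (n + 1)
  have h1 := one_le_endpt 0
  have h2 := endpt_pos (2 * (n + 1))
  unfold Matrix.IsHyperbolic
  rw [Matrix.discr_fin_two, Matrix.SpecialLinearGroup.det_coe, Matrix.trace_fin_two]
  simp only [gen, Matrix.of_apply, Matrix.cons_val', Matrix.cons_val_zero, Matrix.cons_val_one,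
    Matrix.cons_val_fin_one]
  have e : (1 / rad (n + 1) + (rad (n + 1) ^ 2 - ctr (n + 1) ^ 2) / rad (n + 1)) ^ 2 - 4 * 1 =
      ((ctr (n + 1) ^ 2 - rad (n + 1) ^ 2 - 1) ^ 2 - (2 * rad (n + 1)) ^ 2) / rad (n + 1) ^ 2 := by
    field_simp
    ring
  rw [e]
  apply div_pos _ (by positivity)
  rw [sub_pos]
  apply pow_lt_pow_left₀ _ (by positivity) two_ne_zero
  have : ctr (n + 1) ^ 2 - rad (n + 1) ^ 2 = endpt (2 * n + 1) * endpt (2 * (n + 1)) := by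
    rw [← e1, ← e2]; ring
  rw [this]
  have : 2 * rad (n + 1) = endpt (2 * (n + 1)) - endpt (2 * n + 1) := by
    rw [← e1, ← e2]; ring
  rw [this]
  nlinarith

theorem isInfiniteSchottky_gen : IsInfiniteSchottky gen := by
  refine ⟨isHyperbolic_gen, I, ?_⟩
  have hmix : ∀ n m, Metric.AreSeparated (schottkyHalfPlane gen I (n, true))
      (schottkyHalfPlane gen I (m, false)) := fun n m => by
    have h1 := endpt_strictMono (show 0 < 2 * n + 1 by omega)
    have h2 := endpt_strictMono (show 0 < 2 * m + 1 by omega)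
    have h3 := one_le_endpt 0
    refine areSeparated_of_norm (inv_pos.mpr (endpt_pos (2 * n + 1))) ?_
      (fun z hz => (mem_schottkyHalfPlane_true hz).2)
      (fun z hz => (mem_schottkyHalfPlane_false hz).1)
    exact (inv_le_one_of_one_le₀ (by linarith)).trans_lt (by linarith)
  have hff : ∀ n m, n < m → Metric.AreSeparated (schottkyHalfPlane gen I (n, false))
      (schottkyHalfPlane gen I (m, false)) := fun n m h =>
    areSeparated_of_norm (endpt_pos _) (endpt_strictMono (show 2 * n + 2 < 2 * m + 1 by omega))
      (fun z hz => (mem_schottkyHalfPlane_false hz).2)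
      (fun z hz => (mem_schottkyHalfPlane_false hz).1)
  have htt : ∀ n m, n < m → Metric.AreSeparated (schottkyHalfPlane gen I (m, true))
      (schottkyHalfPlane gen I (n, true)) := fun n m h =>
    areSeparated_of_norm (inv_pos.mpr (endpt_pos _))
      (inv_strictAnti₀ (endpt_pos _) (endpt_strictMono (show 2 * n + 2 < 2 * m + 1 by omega)))
      (fun z hz => (mem_schottkyHalfPlane_true hz).2)
      (fun z hz => (mem_schottkyHalfPlane_true hz).1)
  rintro ⟨n, b⟩ ⟨m, c⟩ hne
  have hnm : b = c → n < m ∨ m < n := fun h => by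
    subst h
    exact Nat.lt_or_gt_of_ne fun h => hne (by rw [h])
  cases b <;> cases c
  · rcases hnm rfl with h | h
    · exact hff _ _ h
    · exact (hff _ _ h).symm
  · exact (hmix _ _).symm
  · exact hmix _ _
  · rcases hnm rfl with h | h
    · exact (htt _ _ h).symm
    · exact htt _ _ h

/-! ## The bisector construction -/

theorem two_pow_mul_endpt_succ_le (n : ℕ) :
    64 * 2 ^ (n + 1) * endpt (2 * n + 1) ≤ endpt (2 * n + 2) := by
  have := endpt_mul_le (show 2 * n + 1 < 2 * n + 2 by omega)
    (show n + 1 + 6 ≤ 4 * (2 * n + 1 + (2 * n + 2)) by omega)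
  rw [pow_add] at this
  linarith

theorem two_pow_le_endpt (n : ℕ) : 2 ^ n ≤ endpt (2 * n + 1) := by
  have := endpt_mul_le (show 0 < 2 * n + 1 by omega) (show n ≤ 4 * (0 + (2 * n + 1)) by omega)
  have h := one_le_endpt 0
  have : (2 : ℝ) ^ n ≤ 2 ^ n * endpt 0 := le_mul_of_one_le_right (by positivity) h
  linarith

theorem ctr_sq_sub_rad_sq (n : ℕ) :
    ctr (n + 1) ^ 2 - rad (n + 1) ^ 2 = endpt (2 * n + 1) * endpt (2 * n + 2) := by
  simp only [ctr, rad]; ring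

theorem im_refl_smul_I (n : ℕ) :
    (refl n • (I : ℍ)).im = rad n ^ 2 / (ctr n ^ 2 + 1) := by
  rw [im_refl_smul, centreDistSq]
  simp

theorem re_refl_smul_I (n : ℕ) :
    (refl n • (I : ℍ)).re = ctr n * (ctr n ^ 2 - rad n ^ 2 + 1) / (ctr n ^ 2 + 1) := by
  rw [re_refl_smul, centreDistSq]
  have : 0 < ctr n ^ 2 + 1 := by positivity
  simp
  field_simp
  ring

theorem isBisectorConstruction_gen : IsBisectorConstruction gen := by
  have him : ∀ n, (refl (n + 1) • (I : ℍ)).im =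
      (1 + (endpt (2 * n + 1) * endpt (2 * n + 2) + 1) / rad (n + 1) ^ 2)⁻¹ := fun n => by
    have := (rad_pos (n + 1)).ne'
    rw [im_refl_smul_I, ← ctr_sq_sub_rad_sq, ← inv_div]
    congr 1
    field_simp
    ring
  have hpos : ∀ n, 0 < (endpt (2 * n + 1) * endpt (2 * n + 2) + 1) / rad (n + 1) ^ 2 := fun n => by
    have := rad_pos (n + 1)
    have := endpt_pos (2 * n + 1)
    have := endpt_pos (2 * n + 2)
    positivity
  refine ⟨fun n => Real.log (1 + (endpt (2 * n + 1) * endpt (2 * n + 2) + 1) / rad (n + 1) ^ 2),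
    fun n => refl (n + 1) • I, reflIsometry 0, fun n => Real.log_pos (by linarith [hpos n]), ?_,
    fun n => ⟨?_, ?_⟩, ?_, isReflection_refl_zero, fun n =>
      ⟨reflIsometry (n + 1), isReflection_refl n, gen_smul n⟩⟩
  -- As `log (1 + x) ≤ x`, it is enough that `(lo * hi + 1) / rad^2 ≤ 2^(-n)`; this follows from
  -- `rad ≥ hi / 4` and `hi ≥ 64 * 2^(n+1) * lo`.
  · have hlim : Tendsto (fun n : ℕ => ((1 : ℝ) / 2) ^ n) atTop (𝓝 0) :=
      tendsto_pow_atTop_nhds_zero_of_lt_one (by norm_num) (by norm_num)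
    refine squeeze_zero (fun n => Real.log_nonneg (by linarith [hpos n])) (fun n => ?_) hlim
    refine (Real.log_le_sub_one_of_pos (by linarith [hpos n])).trans ?_
    rw [add_sub_cancel_left, one_div, inv_pow]
    have h1 := two_pow_mul_endpt_succ_le n
    have h2 := one_le_endpt (2 * n + 1)
    have h3 := one_le_endpt (2 * n + 2)
    have hE : (1 : ℝ) ≤ 2 ^ n := one_le_pow₀ (by norm_num)
    rw [pow_succ] at h1
    simp only [rad]
    have h4 : endpt (2 * n + 1) ≤ endpt (2 * n + 2) / 2 := by nlinarith
    rw [div_le_iff₀ (pow_pos (by linarith) 2), inv_mul_eq_div, le_div_iff₀ (by positivity)]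
    have h5 : (endpt (2 * n + 2) / 4) ^ 2 ≤ ((endpt (2 * n + 2) - endpt (2 * n + 1)) / 2) ^ 2 :=
      pow_le_pow_left₀ (by linarith) (by linarith) 2
    have h6 : endpt (2 * n + 1) * endpt (2 * n + 2) + 1 ≤
      2 * (endpt (2 * n + 1) * endpt (2 * n + 2)) := by nlinarith
    refine le_trans ?_ h5
    calc _ ≤ 2 * (endpt (2 * n + 1) * endpt (2 * n + 2)) * 2 ^ n :=
          mul_le_mul_of_nonneg_right h6 (by positivity)
      _ = (64 * (2 ^ n * 2) * endpt (2 * n + 1)) * (endpt (2 * n + 2) / 64) := by ring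
      _ ≤ endpt (2 * n + 2) * (endpt (2 * n + 2) / 64) :=
          mul_le_mul_of_nonneg_right h1 (by linarith)
      _ ≤ _ := by nlinarith
  · rw [re_refl_smul_I, ctr_sq_sub_rad_sq]
    have := ctr_succ_pos n
    have := endpt_pos (2 * n + 1)
    have := endpt_pos (2 * n + 2)
    positivity
  · rw [him, Real.exp_neg, Real.exp_log (by linarith [hpos n])]
  · have hlim : Tendsto (fun n : ℕ => (2 : ℝ)⁻¹ * 2 ^ n) atTop atTop :=
      (tendsto_pow_atTop_atTop_of_one_lt (by norm_num)).const_mul_atTop (by norm_num)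
    refine tendsto_atTop_mono (fun n => ?_) hlim
    rw [re_refl_smul_I, ctr_sq_sub_rad_sq]
    have hc := ctr_succ_pos n
    have h1 := two_pow_le_endpt n
    have h2 := one_le_endpt (2 * n + 2)
    have h3 := one_le_endpt (2 * n + 1)
    have h5 := endpt_strictMono (show 2 * n + 1 < 2 * n + 2 by omega)
    have h4 : ctr (n + 1) ≤ endpt (2 * n + 2) := by simp only [ctr]; linarith
    have h6 : 1 ≤ ctr (n + 1) := by simp only [ctr]; linarith
    rw [le_div_iff₀ (by positivity)]
    have h7 : 2 ^ n * ctr (n + 1) ≤ endpt (2 * n + 1) * endpt (2 * n + 2) :=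
      mul_le_mul h1 h4 hc.le (by linarith)
    have h8 : (ctr (n + 1) ^ 2 + 1) * 2⁻¹ ≤ ctr (n + 1) ^ 2 := by nlinarith
    have h9 : (0 : ℝ) < 2 ^ n := by positivity
    calc 2⁻¹ * 2 ^ n * (ctr (n + 1) ^ 2 + 1) = 2 ^ n * ((ctr (n + 1) ^ 2 + 1) * 2⁻¹) := by ring
      _ ≤ 2 ^ n * ctr (n + 1) ^ 2 := mul_le_mul_of_nonneg_left h8 h9.le
      _ = ctr (n + 1) * (2 ^ n * ctr (n + 1)) := by ring
      _ ≤ ctr (n + 1) * (endpt (2 * n + 1) * endpt (2 * n + 2) + 1) :=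
        mul_le_mul_of_nonneg_left (by linarith) hc.le

/-! ## Geodesics orthogonal to the unit circle -/

/-- The geodesic orthogonal to the unit circle with Euclidean centre `m > 1`. -/
def orthoCircle (m : ℝ) : Set ℍ := {z | z.re ^ 2 + z.im ^ 2 + 1 = 2 * m * z.re}

/-- The image of `i` under the reflection across `orthoCircle m`. -/
def mirrorI (m : ℝ) (hm : 1 < m) : ℍ :=
  ⟨⟨2 * m / (m ^ 2 + 1), (m ^ 2 - 1) / (m ^ 2 + 1)⟩, by
    have : 0 < m ^ 2 - 1 := by nlinarith
    change 0 < (m ^ 2 - 1) / (m ^ 2 + 1)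
    positivity⟩

theorem cosh_dist_mirrorI_sub (m : ℝ) (hm : 1 < m) (z : ℍ) :
    Real.cosh (dist z (mirrorI m hm)) - Real.cosh (dist z I) =
      (z.re ^ 2 + z.im ^ 2 + 1 - 2 * m * z.re) / (z.im * (m ^ 2 - 1)) := by
  have h1 : 0 < m ^ 2 - 1 := by nlinarith
  have h2 : 0 < m ^ 2 + 1 := by positivity
  have hz := z.im_pos
  have hre : (mirrorI m hm).re = 2 * m / (m ^ 2 + 1) := rfl
  have him : (mirrorI m hm).im = (m ^ 2 - 1) / (m ^ 2 + 1) := rfl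
  rw [cosh_dist_eq, cosh_dist_eq, hre, him]
  simp only [UpperHalfPlane.I_re, UpperHalfPlane.I_im]
  field_simp
  ring

theorem dist_mirrorI_le_iff (m : ℝ) (hm : 1 < m) (z : ℍ) :
    dist z (mirrorI m hm) ≤ dist z I ↔ z.re ^ 2 + z.im ^ 2 + 1 ≤ 2 * m * z.re := by
  have h1 : 0 < m ^ 2 - 1 := by nlinarith
  have hz := z.im_pos
  rw [dist_le_dist_iff, ← sub_nonpos, cosh_dist_mirrorI_sub, div_le_iff₀ (by positivity), zero_mul,
    sub_nonpos]

theorem le_dist_mirrorI_iff (m : ℝ) (hm : 1 < m) (z : ℍ) :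
    dist z I ≤ dist z (mirrorI m hm) ↔ 2 * m * z.re ≤ z.re ^ 2 + z.im ^ 2 + 1 := by
  have h1 : 0 < m ^ 2 - 1 := by nlinarith
  have hz := z.im_pos
  rw [dist_le_dist_iff, ← sub_nonneg, cosh_dist_mirrorI_sub, le_div_iff₀ (by positivity), zero_mul,
    sub_nonneg]

theorem bisector_mirrorI (m : ℝ) (hm : 1 < m) : bisector (mirrorI m hm) I = orthoCircle m := by
  ext z
  change dist z _ = dist z _ ↔ _ = _
  rw [le_antisymm_iff, dist_mirrorI_le_iff, le_dist_mirrorI_iff, ← le_antisymm_iff]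

theorem mirrorI_ne (m : ℝ) (hm : 1 < m) : mirrorI m hm ≠ I := fun h => by
  have h1 := congrArg UpperHalfPlane.re h
  have hre : (mirrorI m hm).re = 2 * m / (m ^ 2 + 1) := rfl
  rw [hre, UpperHalfPlane.I_re] at h1
  have : 0 < 2 * m / (m ^ 2 + 1) := by positivity
  linarith

/-- The inequality `|z|^2 + 1 ≤ 2 m Re z` forces `Re z > 0`, so it becomes strict when `m` grows. -/
theorem closedHalfPlane_mirrorI_subset {m m' : ℝ} (hm : 1 < m) (h : m < m') :
    closedHalfPlane (mirrorI m hm) I ⊆ openHalfPlane (mirrorI m' (hm.trans h)) I := by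
  intro z hz
  have hz' := (dist_mirrorI_le_iff m hm z).mp hz
  change dist z _ < dist z _
  rw [← not_le, le_dist_mirrorI_iff]
  have := z.im_pos
  have hre : 0 < z.re := by
    by_contra hc
    nlinarith
  nlinarith

/-- The rotation about `i` which carries the imaginary axis to the unit circle. -/
def rotation : SL(2, ℝ) := ⟨!![(√2)⁻¹, (√2)⁻¹; -(√2)⁻¹, (√2)⁻¹], by
  rw [Matrix.det_fin_two_of]
  have : (√2)⁻¹ * (√2)⁻¹ = 1 / 2 := by
    rw [← mul_inv, Real.mul_self_sqrt (by norm_num)]; norm_num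
  linarith⟩

theorem coe_rotation_smul (t : ℝ) : ((rotation • (upward 0 t).base : ℍ) : ℂ) =
    ⟨(1 - Real.exp t ^ 2) / (1 + Real.exp t ^ 2), 2 * Real.exp t / (1 + Real.exp t ^ 2)⟩ := by
  have h2 : ((√2 : ℝ) : ℂ) ≠ 0 := by
    rw [Complex.ofReal_ne_zero]; positivity
  have hden := den_ne_zero rotation (upward 0 t).base
  rw [coe_specialLinearGroup_apply]
  simp only [Algebra.algebraMap_self, RingHom.id_apply]
  rw [div_eq_iff hden]
  have hE : 0 < 1 + Real.exp t ^ 2 := by positivity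
  have hb : ((upward 0 t).base : ℂ) = ⟨0, Real.exp t⟩ := rfl
  rw [hb]
  apply Complex.ext
  · simp [rotation, -Complex.ofReal_exp]
    field_simp
    ring
  · simp [rotation, -Complex.ofReal_exp]
    field_simp
    ring

/-- The parameter of the point of `orthoCircle m` on the unit circle. -/
def footTime (m : ℝ) : ℝ := Real.log √((m - 1) / (m + 1))

/-- The point of `orthoCircle m` on the unit circle. -/
def foot (m : ℝ) : ℍ := rotation • (upward 0 (footTime m)).base

theorem exp_footTime_sq {m : ℝ} (hm : 1 < m) : Real.exp (footTime m) ^ 2 = (m - 1) / (m + 1) := by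
  have : 0 < (m - 1) / (m + 1) := div_pos (by linarith) (by linarith)
  rw [footTime, Real.exp_log (Real.sqrt_pos.mpr this), Real.sq_sqrt this.le]

theorem footTime_lt {m m' : ℝ} (hm : 1 < m) (h : m < m') : footTime m < footTime m' := by
  unfold footTime
  have : 0 < (m - 1) / (m + 1) := div_pos (by linarith) (by linarith)
  apply Real.log_lt_log (Real.sqrt_pos.mpr this)
  apply Real.sqrt_lt_sqrt this.le
  rw [div_lt_div_iff₀ (by linarith) (by linarith)]
  nlinarith

theorem foot_re {m : ℝ} (hm : 1 < m) : (foot m).re = 1 / m := by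
  rw [← UpperHalfPlane.coe_re, foot, coe_rotation_smul]
  change _ / _ = _
  rw [exp_footTime_sq hm]
  have : m + 1 ≠ 0 := by linarith
  have : 1 + (m - 1) / (m + 1) = 2 * m / (m + 1) := by field_simp; ring
  rw [this]
  have : 1 - (m - 1) / (m + 1) = 2 / (m + 1) := by field_simp; ring
  rw [this]
  have : m ≠ 0 := by linarith
  field_simp

theorem foot_norm (m : ℝ) : (foot m).re ^ 2 + (foot m).im ^ 2 = 1 := by
  rw [← UpperHalfPlane.coe_re, ← UpperHalfPlane.coe_im, foot, coe_rotation_smul]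
  have hE : 0 < 1 + Real.exp (footTime m) ^ 2 := by positivity
  simp only
  field_simp
  ring

theorem foot_mem {m : ℝ} (hm : 1 < m) : foot m ∈ orthoCircle m := by
  change _ + 1 = _
  rw [foot_norm, foot_re hm]
  have : m ≠ 0 := by linarith
  field_simp
  norm_num

/-- For `y` on the unit circle, the distance to a point `w` of `orthoCircle m` is an increasing
function of `Re w / Im w`. This slope is least where the line from `0` is tangent to `orthoCircle
m`, which is on the unit circle by orthogonality. -/
theorem dist_foot_le {m : ℝ} (hm : 1 < m) {y z : ℍ} (hy : y.re ^ 2 + y.im ^ 2 = 1)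
    (hym : y.re < m) (hz : z ∈ orthoCircle m) : dist y (foot m) ≤ dist y z := by
  have key : ∀ w ∈ orthoCircle m, Real.cosh (dist y w) = (m - y.re) / y.im * (w.re / w.im) := by
    intro w hw
    have hw' : w.re ^ 2 + w.im ^ 2 + 1 = 2 * m * w.re := hw
    have h1 := w.im_pos
    have h2 := y.im_pos
    rw [cosh_dist_eq]
    field_simp
    linear_combination hw' + hy
  rw [dist_le_dist_iff, key _ (foot_mem hm), key _ hz]
  apply mul_le_mul_of_nonneg_left _ (div_nonneg (by linarith) y.im_pos.le)
  rw [div_le_div_iff₀ (foot m).im_pos z.im_pos]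
  have hz' : z.re ^ 2 + z.im ^ 2 + 1 = 2 * m * z.re := hz
  have hzre : 0 < z.re := by
    have := z.im_pos
    by_contra hc
    nlinarith
  have hf := foot_norm m
  have hre := foot_re hm
  have hm0 : (0 : ℝ) < m := by linarith
  have hfm : m * (foot m).re = 1 := by rw [hre]; field_simp
  apply le_of_sq_le_sq _ (mul_pos hzre (foot m).im_pos).le
  have e : (foot m).im ^ 2 = 1 - (foot m).re ^ 2 := by linarith
  have e2 : z.im ^ 2 = 2 * m * z.re - 1 - z.re ^ 2 := by linarith
  rw [mul_pow, mul_pow, e, e2]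
  have : (z.re - (foot m).re) ^ 2 = z.re ^ 2 * (1 - (foot m).re ^ 2) -
      (foot m).re ^ 2 * (2 * m * z.re - 1 - z.re ^ 2) := by
    linear_combination (2 * z.re * (foot m).re) * hfm
  linarith [sq_nonneg (z.re - (foot m).re)]

theorem isCommonPerpendicular_foot {m m' : ℝ} (hm : 1 < m) (hm' : 1 < m') :
    IsCommonPerpendicular (orthoCircle m) (orthoCircle m') (foot m) (foot m') := by
  have h : ∀ a : ℝ, 1 < a → 1 / a < 1 := fun a ha => by
    rw [div_lt_one (by linarith)]; exact ha
  refine ⟨foot_mem hm, foot_mem hm', fun x hx => ?_, fun y hy => ?_⟩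
  · exact dist_foot_le hm (foot_norm m') (by rw [foot_re hm']; linarith [h m' hm']) hx
  · exact dist_foot_le hm' (foot_norm m) (by rw [foot_re hm]; linarith [h m hm]) hy

/-! ## The flows on upward vectors -/

/-- The isometry `z ↦ e ^ t * z + s`. -/
def affine (s t : ℝ) : SL(2, ℝ) :=
  ⟨!![Real.exp (t / 2), s * Real.exp (-(t / 2)); 0, Real.exp (-(t / 2))], by
    rw [Matrix.det_fin_two_of, ← Real.exp_add]; simp⟩

theorem affine_smul_upward (s t s' t' : ℝ) :
    affine s t • upward s' t' = upward (s + Real.exp t * s') (t + t') := by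
  have e1 : Real.exp (-(t / 2)) = (Real.exp (t / 2))⁻¹ := Real.exp_neg _
  have e2 : Real.exp t = Real.exp (t / 2) ^ 2 := by rw [← Real.exp_nat_mul]; congr 1; push_cast; ring
  have hE := Real.exp_pos (t / 2)
  have hb : ∀ a b, ((upward a b).base : ℂ) = ⟨a, Real.exp b⟩ := fun _ _ => rfl
  have hd : ∀ a b, (upward a b).dir = ⟨0, Real.exp b⟩ := fun _ _ => rfl
  apply UTH.ext
  · apply UpperHalfPlane.ext
    rw [base_smul, coe_specialLinearGroup_apply, hb, hb]
    simp only [affine, Matrix.of_apply, Matrix.cons_val', Matrix.cons_val_zero, Matrix.cons_val_one,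
      Matrix.cons_val_fin_one, Algebra.algebraMap_self, RingHom.id_apply, Complex.ofReal_zero,
      zero_mul, zero_add]
    rw [div_eq_iff (by rw [Complex.ofReal_ne_zero]; positivity), e1, Real.exp_add, e2]
    apply Complex.ext
    · simp [-Complex.ofReal_exp]; field_simp; ring
    · simp [-Complex.ofReal_exp]; field_simp
  · rw [dir_smul, hb, hd, hd]
    simp only [affine, Matrix.of_apply, Matrix.cons_val', Matrix.cons_val_zero, Matrix.cons_val_one,
      Matrix.cons_val_fin_one, Complex.ofReal_zero,
      zero_mul, zero_add]
    rw [div_eq_iff (pow_ne_zero 2 (by rw [Complex.ofReal_ne_zero]; positivity)), e1, Real.exp_add,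
      e2, ← Complex.ofReal_pow]
    apply Complex.ext
    · simp [-Complex.ofReal_exp, -Complex.ofReal_pow, -Complex.ofReal_inv]
    · simp [-Complex.ofReal_exp, -Complex.ofReal_pow, -Complex.ofReal_inv]; field_simp

theorem frame_upward_smul (s t : ℝ) (v : UTH) : frame (upward s t) • v = affine s t • v :=
  smul_eq_of_smul_upward_eq _ _ (by rw [frame_smul, affine_smul_upward]; simp) v

theorem geodesicFlowH_upward (t' s t : ℝ) : geodesicFlowH t' (upward s t) = upward s (t + t') := by
  rw [geodesicFlowH, frame_upward_smul, affine_smul_upward]; simp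

theorem horocycleFlowH_upward (s' s t : ℝ) :
    horocycleFlowH s' (upward s t) = upward (s + Real.exp t * s') t := by
  rw [horocycleFlowH, frame_upward_smul, affine_smul_upward, add_zero]

theorem upward_re (s t : ℝ) : (upward s t).base.re = s := rfl

theorem upward_im (s t : ℝ) : (upward s t).base.im = Real.exp t := rfl

theorem dist_upward (s t : ℝ) : dist (upward 0 s).base (upward 0 t).base = |s - t| := by
  rw [UpperHalfPlane.dist_of_re_eq
    (show (upward 0 s).base.re = (upward 0 t).base.re from rfl), upward_im, upward_im, Real.log_exp, Real.log_exp,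
    Real.dist_eq]

/-- As `log Im` is 1-Lipschitz, a point of the segment is exactly as far from the lower end as the
point of the imaginary axis at its own height, which forces its real part to vanish. -/
theorem eq_upward_of_mem_geodSegment {s t : ℝ} (hst : s ≤ t) {z : ℍ}
    (h : z ∈ geodSegment (upward 0 s).base (upward 0 t).base) :
    ∃ r, s ≤ r ∧ z = (upward 0 r).base := by
  have h' : dist (upward 0 s).base z + dist z (upward 0 t).base =
    dist (upward 0 s).base (upward 0 t).base := h
  have h1 := UpperHalfPlane.dist_log_im_le (upward 0 s).base z
  have h2 := UpperHalfPlane.dist_log_im_le z (upward 0 t).base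
  rw [upward_im, Real.log_exp, Real.dist_eq] at h1 h2
  rw [dist_upward, abs_of_nonpos (sub_nonpos.mpr hst)] at h'
  set r := Real.log z.im
  have a1 := neg_abs_le (s - r)
  have a2 := neg_abs_le (r - t)
  have a3 := le_abs_self (s - r)
  refine ⟨r, by linarith, ?_⟩
  have h3 : dist (upward 0 s).base z = dist (upward 0 s).base (upward 0 r).base := by
    rw [dist_upward]; linarith
  have h4 := congrArg Real.cosh h3
  have him : (upward 0 r).base.im = z.im := Real.exp_log z.im_pos
  rw [cosh_dist_eq, cosh_dist_eq, him] at h4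
  simp only [upward_re, upward_im] at h4
  have hz := z.im_pos
  have hs := Real.exp_pos s
  field_simp at h4
  have hre : z.re = 0 := by
    have : z.re ^ 2 = 0 := by linarith
    exact pow_eq_zero_iff two_ne_zero |>.mp this
  apply UpperHalfPlane.ext
  apply Complex.ext
  · exact hre
  · exact him.symm

theorem geodSegment_foot_subset {a m m' : ℝ} (ha : footTime a ≤ footTime m) (hm : 1 < m) (h : m < m') :
    geodSegment (foot m) (foot m') ⊆ ray (rotation • upward 0 (footTime a)) := by
  intro z hz
  have hz' : dist (foot m) z + dist z (foot m') = dist (foot m) (foot m') := hz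
  have h2 : rotation⁻¹ • z ∈
      geodSegment (upward 0 (footTime m)).base (upward 0 (footTime m')).base := by
    change dist _ _ + dist _ _ = dist _ _
    rw [← dist_smul rotation, ← dist_smul rotation (rotation⁻¹ • z), smul_inv_smul,
      ← dist_smul rotation (upward 0 (footTime m)).base]
    exact hz'
  obtain ⟨r, hr, e⟩ := eq_upward_of_mem_geodSegment (footTime_lt hm h).le h2
  refine ⟨r - footTime a, by linarith, ?_⟩
  rw [geodesicFlowH_smul, geodesicFlowH_upward, base_smul, add_sub_cancel, ← e, smul_inv_smul]

/-! ## The axes of the generators -/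

/-- The Euclidean centre of the axis of a generator. -/
def axisCentre (n : ℕ) : ℝ :=
  (endpt (2 * n + 1) * endpt (2 * n + 2) + 1) / (endpt (2 * n + 1) + endpt (2 * n + 2))

theorem one_lt_axisCentre (n : ℕ) : 1 < axisCentre n := by
  have h0 := one_le_endpt 0
  have h1 := endpt_strictMono (show 0 < 2 * n + 1 by omega)
  have h2 := endpt_strictMono (show 0 < 2 * n + 2 by omega)
  rw [axisCentre, one_lt_div (by linarith)]
  nlinarith

theorem axisCentre_lt (n : ℕ) : axisCentre n < axisCentre (n + 1) := by
  have h0 := one_le_endpt (2 * n + 1)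
  have h1 := endpt_strictMono (show 2 * n + 1 < 2 * n + 2 by omega)
  have h2 := endpt_mul_le (show 2 * n + 2 < 2 * (n + 1) + 1 by omega)
    (show 1 ≤ 4 * (2 * n + 2 + (2 * (n + 1) + 1)) by omega)
  have h3 := endpt_strictMono (show 2 * (n + 1) + 1 < 2 * (n + 1) + 2 by omega)
  have a : axisCentre n < endpt (2 * n + 2) := by
    rw [axisCentre, div_lt_iff₀ (by linarith)]
    nlinarith
  refine a.trans_le ?_
  rw [axisCentre, le_div_iff₀ (by linarith)]
  nlinarith

theorem axisCentre_strictMono : StrictMono axisCentre := strictMono_nat_of_lt_succ axisCentre_lt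

/-- Only the last term depends on `z`; it is nonnegative and vanishes exactly on `orthoCircle
(axisCentre n)`, which is therefore the axis. -/
theorem cosh_dist_gen_smul (n : ℕ) (z : ℍ) : Real.cosh (dist z (gen n • z)) =
    1 + 2 * ctr (n + 1) ^ 2 * (axisCentre n ^ 2 - 1) / rad (n + 1) ^ 2 +
      ctr (n + 1) ^ 2 * (z.re ^ 2 + z.im ^ 2 + 1 - 2 * axisCentre n * z.re) ^ 2 /
        (2 * z.im ^ 2 * rad (n + 1) ^ 2) := by
  have hm : axisCentre n = (ctr (n + 1) ^ 2 - rad (n + 1) ^ 2 + 1) / (2 * ctr (n + 1)) := by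
    rw [ctr_sq_sub_rad_sq, axisCentre]
    simp only [ctr]
    congr 1
    ring
  rw [hm, gen_smul, ← dist_refl_smul 0, refl_smul_smul, cosh_dist_eq, re_refl_smul, re_refl_smul,
    im_refl_smul, im_refl_smul]
  have h1 := centreDistSq_pos 0 z
  have h2 := centreDistSq_pos (n + 1) z
  have hr := rad_pos (n + 1)
  have hc := ctr_succ_pos n
  have hz := z.im_pos
  unfold centreDistSq at *
  simp only [show ctr 0 = 0 from rfl, show rad 0 = 1 from rfl, sub_zero] at *
  field_simp
  ring

theorem axis_gen (n : ℕ) : axis (gen n) = orthoCircle (axisCentre n) := by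
  have hr := rad_pos (n + 1)
  have hc := ctr_succ_pos n
  ext z
  constructor
  · intro h
    have h1 := (dist_le_dist_iff _ _ _ _).mp (h (foot (axisCentre n)))
    have hf : _ = _ := foot_mem (one_lt_axisCentre n)
    rw [cosh_dist_gen_smul, cosh_dist_gen_smul, hf, sub_self] at h1
    change _ = _
    by_contra hne
    have h2 : 0 < (z.re ^ 2 + z.im ^ 2 + 1 - 2 * axisCentre n * z.re) ^ 2 :=
      (sq_nonneg _).lt_of_ne' (pow_ne_zero 2 (sub_ne_zero.mpr hne))
    have hz := z.im_pos
    have : 0 < ctr (n + 1) ^ 2 * (z.re ^ 2 + z.im ^ 2 + 1 - 2 * axisCentre n * z.re) ^ 2 /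
        (2 * z.im ^ 2 * rad (n + 1) ^ 2) := by positivity
    simp at h1
    linarith
  · intro h w
    have h' : _ = _ := h
    rw [dist_le_dist_iff, cosh_dist_gen_smul, cosh_dist_gen_smul, h', sub_self]
    have hw := w.im_pos
    have : 0 ≤ ctr (n + 1) ^ 2 * (w.re ^ 2 + w.im ^ 2 + 1 - 2 * axisCentre n * w.re) ^ 2 /
        (2 * w.im ^ 2 * rad (n + 1) ^ 2) := by positivity
    simp
    linarith

theorem isUntwistedFlute_gen : IsUntwistedFlute gen := by
  refine ⟨⟨isInfiniteSchottky_gen, fun n => mirrorI (axisCentre n) (one_lt_axisCentre n),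
    fun _ => I, fun n => ⟨mirrorI_ne _ _, ?_⟩, fun n => ?_⟩,
    rotation • upward 0 (footTime (axisCentre 0)), fun n =>
      ⟨foot (axisCentre n), foot (axisCentre (n + 1)), ?_, ?_⟩⟩
  · rw [axis_gen, bisector_mirrorI]
  · exact closedHalfPlane_mirrorI_subset _ (axisCentre_lt n)
  · rw [axis_gen, axis_gen]
    exact isCommonPerpendicular_foot (one_lt_axisCentre _) (one_lt_axisCentre _)
  · refine geodSegment_foot_subset ?_ (one_lt_axisCentre n) (axisCentre_lt n)
    rcases n.eq_zero_or_pos with rfl | hn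
    · rfl
    · exact (footTime_lt (one_lt_axisCentre 0) (axisCentre_strictMono hn)).le

/-! ## The displacement of points of the imaginary axis -/

/-- Ping-pong in the plane; `0 ≤ t` keeps the starting point `e^t i` out of the open unit disc. -/
theorem word_smul_upward (a : ℕ) (l : List ℕ) (h : (a :: l).IsChain (· ≠ ·)) {t : ℝ} (ht : 0 ≤ t) :
    centreDistSq a (word (a :: l) • (upward 0 t).base) ≤ rad a ^ 2 := by
  have step : ∀ (n : ℕ) (z : ℍ), rad n ^ 2 ≤ centreDistSq n z →
      centreDistSq n (refl n • z) ≤ rad n ^ 2 := by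
    intro n z hz
    have hr := rad_pos n
    rw [centreDistSq_refl_smul, div_le_iff₀ (centreDistSq_pos n z)]
    nlinarith [mul_le_mul_of_nonneg_left hz (sq_nonneg (rad n))]
  induction l generalizing a with
  | nil =>
    rw [word_cons, word_nil, mul_one]
    apply step
    rw [centreDistSq, upward_re, upward_im]
    cases a with
    | zero =>
      simp only [ctr, rad]
      nlinarith [Real.one_le_exp ht]
    | succ n =>
      have := ctr_sub_rad n
      nlinarith [endpt_pos (2 * n + 1), rad_pos (n + 1), Real.exp_pos t]
  | cons b l ih =>
    rw [List.isChain_cons_cons] at h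
    obtain ⟨hab, hbl⟩ := h
    rw [word_cons, mul_smul]
    apply step
    have hb := ih b hbl
    set z := word (b :: l) • (upward 0 t).base
    have hz := z.im_pos
    have ha := rad_pos a
    have hb' := rad_pos b
    have h1 : |z.re - ctr b| ≤ rad b := abs_le_of_sq_le_sq (by unfold centreDistSq at hb; nlinarith) hb'.le
    rw [abs_le] at h1
    unfold centreDistSq
    rcases hab.lt_or_gt with hlt | hlt
    · have := ctr_add_rad_lt hlt
      nlinarith
    · have := ctr_add_rad_lt hlt
      nlinarith

theorem log_endpt (k : ℕ) : Real.log (endpt k) = k ^ 2 * Real.log 16 := by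
  rw [endpt, Real.log_pow]; push_cast; rfl

theorem le_dist_of_lt {a b : ℕ} (hab : a < b) {z w : ℍ} (hz : centreDistSq a z ≤ rad a ^ 2)
    (hw : centreDistSq b w ≤ rad b ^ 2) : b * Real.log 16 ≤ dist z w := by
  obtain ⟨b, rfl⟩ : ∃ k, b = k + 1 := ⟨b - 1, by omega⟩
  have h1 := Real.log_le_log (norm_pos_iff.mpr z.ne_zero) (norm_le_of_centreDistSq_le hz)
  have h2 := Real.log_le_log (endpt_pos _) (le_norm_of_centreDistSq_le hw)
  have h3 := log_norm_sub_le_dist w z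
  rw [log_endpt] at h1 h2
  rw [dist_comm]
  have hL : 0 < Real.log 16 := Real.log_pos (by norm_num)
  have hab' : (a : ℝ) ≤ b := by exact_mod_cast Nat.lt_succ_iff.mp hab
  have ha : (0 : ℝ) ≤ a := Nat.cast_nonneg a
  push_cast at h1 h2 ⊢
  have : ((b : ℝ) + 1) + (2 * a) ^ 2 ≤ (2 * b + 1) ^ 2 := by nlinarith
  nlinarith [mul_le_mul_of_nonneg_right this hL.le]

/-- Elements of the group other than the identity displace the points of the imaginary axis
which are close to infinity by a large amount. -/
theorem exists_le_dist_smul_upward (K : ℝ) : ∃ T : ℝ, ∀ t ≥ T, ∀ g ∈ groupOf gen, g ≠ 1 →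
    K ≤ dist (upward 0 t).base (g • (upward 0 t).base) := by
  have hL : 0 < Real.log 16 := Real.log_pos (by norm_num)
  obtain ⟨N, hN⟩ := exists_nat_gt (K / Real.log 16)
  rw [div_lt_iff₀ hL] at hN
  refine ⟨max 0 ((2 * N) ^ 2 * Real.log 16 + K), fun t ht g hg hne => ?_⟩
  obtain ⟨ht0, ht1⟩ := max_le_iff.mp ht
  obtain ⟨l, hl, e⟩ := exists_word hg
  have hdet : (word l).val.det = 1 := by rw [← e]; exact g.2
  have eg : g • (upward 0 t).base = word l • (upward 0 t).base := by rw [← e]; rfl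
  rw [eg]
  match l, hl with
  | [], _ => exact absurd (Matrix.SpecialLinearGroup.toGL_injective (by simpa using e)) hne
  | a :: l, hl =>
    have h1 := word_smul_upward a l hl ht0
    -- If `a ≤ N`, the image stays in a fixed disc while `e^t i` is high up. Otherwise, undoing the
    -- first inversion leaves a point of the disc `a` and a point of another disc `b`, at distance
    -- at least `N * log 16 > K`.
    rcases le_or_gt a N with ha | ha
    · have h2 := Real.log_le_log (norm_pos_iff.mpr (UpperHalfPlane.ne_zero _))
        (norm_le_of_centreDistSq_le h1)
      have h3 := log_norm_sub_le_dist (upward 0 t).base (word (a :: l) • (upward 0 t).base)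
      have h4 : Real.log ‖((upward 0 t).base : ℂ)‖ = t := by
        have : ((upward 0 t).base : ℂ) = (Real.exp t : ℂ) * Complex.I := by
          apply Complex.ext
          · simp [-Complex.ofReal_exp, upward_re]
          · simp [-Complex.ofReal_exp, upward_im]
        rw [this, norm_mul, Complex.norm_I, mul_one, Complex.norm_real, Real.norm_eq_abs,
          Real.abs_exp, Real.log_exp]
      rw [log_endpt] at h2
      have h5 : (((2 * a : ℕ) : ℝ)) ^ 2 * Real.log 16 ≤ (2 * N) ^ 2 * Real.log 16 := by
        apply mul_le_mul_of_nonneg_right _ hL.le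
        have : (a : ℝ) ≤ N := by exact_mod_cast ha
        push_cast
        exact pow_le_pow_left₀ (by positivity) (by linarith) 2
      linarith
    · cases l with
      | nil => rw [det_word] at hdet; norm_num at hdet
      | cons b l =>
        rw [List.isChain_cons_cons] at hl
        have h2 := word_smul_upward b l hl.2 ht0
        have h3 := word_smul_upward a [] (by simp) ht0
        rw [word_cons, word_nil, mul_one] at h3
        rw [word_cons a, mul_smul, ← dist_refl_smul a, refl_smul_smul]
        have hNa : (N : ℝ) ≤ a := by exact_mod_cast ha.le
        rcases hl.1.lt_or_gt with hlt | hlt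
        · have hab : (a : ℝ) ≤ b := by exact_mod_cast hlt.le
          have := le_dist_of_lt hlt h3 h2
          nlinarith
        · have := le_dist_of_lt hlt h2 h3
          rw [dist_comm] at this
          nlinarith

/-! ## Topology of the unit tangent bundle -/

theorem continuous_base : Continuous UTH.base := continuous_fst.comp continuous_subtype_val

theorem continuous_dir : Continuous UTH.dir := continuous_snd.comp continuous_subtype_val

theorem continuous_uth_iff {X : Type*} [TopologicalSpace X] {f : X → UTH} :
    Continuous f ↔ Continuous (fun x => (f x).base) ∧ Continuous (fun x => (f x).dir) := by
  refine ⟨fun h => ⟨continuous_base.comp h, continuous_dir.comp h⟩, fun h => ?_⟩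
  exact Continuous.subtype_mk (h.1.prodMk h.2) fun x => (f x).2

theorem dir_ne_zero (v : UTH) : v.dir ≠ 0 := by
  intro h
  have hn : ‖v.dir‖ = v.base.im := v.2
  rw [h, norm_zero] at hn
  exact v.base.im_pos.ne hn

theorem continuous_smul_uth : Continuous fun p : SL(2, ℝ) × UTH => p.1 • p.2 := by
  rw [continuous_uth_iff]
  refine ⟨?_, ?_⟩
  · simp only [base_smul]
    exact continuous_fst.smul (continuous_base.comp continuous_snd)
  · simp only [dir_smul]
    have hb : Continuous fun p : SL(2, ℝ) × UTH => ((p.2.base : ℍ) : ℂ) :=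
      UpperHalfPlane.continuous_coe.comp (continuous_base.comp continuous_snd)
    have hd : Continuous fun p : SL(2, ℝ) × UTH => p.2.dir := continuous_dir.comp continuous_snd
    have h10 : Continuous fun p : SL(2, ℝ) × UTH => p.1 1 0 := by fun_prop
    have h11 : Continuous fun p : SL(2, ℝ) × UTH => p.1 1 1 := by fun_prop
    refine hd.div ?_ fun p => pow_ne_zero 2 (den_ne_zero _ _)
    exact (((Complex.continuous_ofReal.comp h10).mul hb).add
      (Complex.continuous_ofReal.comp h11)).pow 2

instance : ContinuousSMul SL(2, ℝ) UTH := ⟨continuous_smul_uth⟩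

instance (Γ : Subgroup SL(2, ℝ)) : ContinuousConstSMul Γ UTH :=
  ⟨fun g => continuous_const_smul (g : SL(2, ℝ))⟩

/-- The square of the upper left entry of a matrix that carries the upward vector at `i` to `v`. -/
def topSq (v : UTH) : ℝ :=
  (‖(v.base : ℂ)‖ ^ 2 / ‖v.dir‖ - ((v.base : ℂ) ^ 2 * (Complex.I / v.dir)).re) / 2

/-- The square of the lower left entry of a matrix that carries the upward vector at `i` to `v`. -/
def botSq (v : UTH) : ℝ := (1 / ‖v.dir‖ - (Complex.I / v.dir).re) / 2

theorem continuous_topSq : Continuous topSq := by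
  have hb : Continuous fun v : UTH => (v.base : ℂ) :=
    UpperHalfPlane.continuous_coe.comp continuous_base
  exact ((((hb.norm.pow 2).div continuous_dir.norm fun v => norm_ne_zero_iff.mpr (dir_ne_zero v)).sub
    (Complex.continuous_re.comp ((hb.pow 2).mul
      (continuous_const.div continuous_dir dir_ne_zero)))).div_const 2)

theorem continuous_botSq : Continuous botSq :=
  ((continuous_const.div continuous_dir.norm fun v => norm_ne_zero_iff.mpr (dir_ne_zero v)).sub
    (Complex.continuous_re.comp (continuous_const.div continuous_dir dir_ne_zero))).div_const 2

/-- For the image of the upward vector at `i` under a matrix with rows `(a, b)` and `(c, d)`, it is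
applied to `w = c i + d` and to `w = a i + b`, and isolates `c^2` and `a^2`. -/
theorem norm_sq_sub_re_sq (w : ℂ) : ‖w‖ ^ 2 - (w ^ 2).re = 2 * w.im ^ 2 := by
  rw [← Complex.normSq_eq_norm_sq, Complex.normSq_apply, pow_two, Complex.mul_re]
  ring

theorem upward_dir (s t : ℝ) : (upward s t).dir = (Real.exp t : ℂ) * Complex.I := by
  apply Complex.ext
  · simp [upward, UTH.dir, -Complex.ofReal_exp]
  · simp [upward, UTH.dir, -Complex.ofReal_exp]

theorem I_div_dir_smul_upward (g : SL(2, ℝ)) (s t : ℝ) :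
    Complex.I / (g • upward s t).dir =
      ((Real.exp t)⁻¹ : ℝ) * (((g 1 0 : ℝ) : ℂ) * (upward s t).base + (g 1 1 : ℝ)) ^ 2 := by
  have h := den_ne_zero g (upward s t).base
  have hE : ((Real.exp t : ℝ) : ℂ) ≠ 0 := by
    rw [Complex.ofReal_ne_zero]; exact (Real.exp_pos t).ne'
  have := Complex.I_ne_zero
  rw [dir_smul, upward_dir, Complex.ofReal_inv]
  field_simp

theorem inv_norm_dir_smul_upward (g : SL(2, ℝ)) (s t : ℝ) :
    1 / ‖(g • upward s t).dir‖ =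
      (Real.exp t)⁻¹ * ‖((g 1 0 : ℝ) : ℂ) * (upward s t).base + (g 1 1 : ℝ)‖ ^ 2 := by
  have h := congrArg norm (I_div_dir_smul_upward g s t)
  rw [norm_div, Complex.norm_I, norm_mul, norm_pow, Complex.norm_real, Real.norm_eq_abs,
    abs_of_pos (inv_pos.mpr (Real.exp_pos t))] at h
  exact h

/-- The value does not involve `s`: like `topSq`, it is constant along horocycles. -/
theorem botSq_smul_upward (g : SL(2, ℝ)) (s t : ℝ) :
    botSq (g • upward s t) = Real.exp t * g 1 0 ^ 2 := by
  rw [botSq, inv_norm_dir_smul_upward, I_div_dir_smul_upward, Complex.re_ofReal_mul, ← mul_sub,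
    norm_sq_sub_re_sq]
  have : (((g 1 0 : ℝ) : ℂ) * (upward s t).base + (g 1 1 : ℝ)).im = g 1 0 * Real.exp t := by
    simp [upward_im]
  rw [this]
  have := Real.exp_pos t
  field_simp

theorem topSq_smul_upward (g : SL(2, ℝ)) (s t : ℝ) :
    topSq (g • upward s t) = Real.exp t * g 0 0 ^ 2 := by
  have hden := den_ne_zero g (upward s t).base
  have hb : ((g • upward s t).base : ℂ) * (((g 1 0 : ℝ) : ℂ) * (upward s t).base + (g 1 1 : ℝ)) =
      ((g 0 0 : ℝ) : ℂ) * (upward s t).base + (g 0 1 : ℝ) := by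
    rw [base_smul, specialLinearGroup_apply]
    exact div_mul_cancel₀ _ hden
  have e1 : ∀ x y : ℝ, x ^ 2 / y = x ^ 2 * (1 / y) := fun x y => by ring
  rw [topSq, e1, inv_norm_dir_smul_upward, I_div_dir_smul_upward,
    mul_left_comm, mul_left_comm (_ ^ 2), ← mul_pow, ← mul_pow, ← norm_mul, hb,
    Complex.re_ofReal_mul, ← mul_sub, norm_sq_sub_re_sq]
  have : (((g 0 0 : ℝ) : ℂ) * (upward s t).base + (g 0 1 : ℝ)).im = g 0 0 * Real.exp t := by
    simp [upward_im]
  rw [this]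
  have := Real.exp_pos t
  field_simp

/-! ## Limits of group elements -/

theorem tendsto_sl_iff {f : ℕ → SL(2, ℝ)} {g : SL(2, ℝ)} :
    Tendsto f atTop (𝓝 g) ↔ ∀ i j, Tendsto (fun n => f n i j) atTop (𝓝 (g i j)) := by
  have h : Tendsto f atTop (𝓝 g) ↔ Tendsto (fun n => (f n).1) atTop (𝓝 g.1) :=
    Matrix.SpecialLinearGroup.isClosedEmbedding_val.isInducing.tendsto_nhds_iff
  refine h.trans (tendsto_pi_nhds.trans (forall_congr' fun i => ?_))
  exact tendsto_pi_nhds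

theorem mul_affine_apply_zero (g : SL(2, ℝ)) (s : ℝ) (i : Fin 2) :
    (g * affine s 0) i 0 = g i 0 := by
  change (g.1 * (affine s 0).1) i 0 = _
  rw [Matrix.mul_apply, Fin.sum_univ_two]
  simp [affine]

theorem mul_affine_apply_one (g : SL(2, ℝ)) (s : ℝ) (i : Fin 2) :
    (g * affine s 0) i 1 = g i 0 * s + g i 1 := by
  change (g.1 * (affine s 0).1) i 1 = _
  rw [Matrix.mul_apply, Fin.sum_univ_two]
  simp [affine]

theorem det_eq_one (g : SL(2, ℝ)) : g 0 0 * g 1 1 - g 0 1 * g 1 0 = 1 := by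
  have := g.det_coe
  rwa [Matrix.det_fin_two] at this

/-- Convergence of first columns suffices up to the horocycle flow: right multiplication by `affine
s 0` keeps the first column, this `s` annihilates the upper right entry, and the determinant fixes
the last one. -/
theorem tendsto_mul_affine_one {g : ℕ → SL(2, ℝ)} (h0 : Tendsto (fun n => g n 0 0) atTop (𝓝 1))
    (h1 : Tendsto (fun n => g n 1 0) atTop (𝓝 0)) :
    Tendsto (fun n => g n * affine (-g n 0 1 / g n 0 0) 0) atTop (𝓝 1) := by
  have hne : ∀ᶠ n in atTop, g n 0 0 ≠ 0 := h0.eventually_ne one_ne_zero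
  rw [tendsto_sl_iff]
  simp only [Fin.forall_fin_two, mul_affine_apply_zero, mul_affine_apply_one,
    Matrix.SpecialLinearGroup.coe_one, Matrix.one_apply_eq, Matrix.one_apply_ne (zero_ne_one (α := Fin 2)),
    Matrix.one_apply_ne (one_ne_zero (α := Fin 2))]
  refine ⟨⟨h0, ?_⟩, h1, ?_⟩
  · refine Tendsto.congr' ?_ tendsto_const_nhds
    filter_upwards [hne] with n hn
    field_simp
    ring
  · have : Tendsto (fun n => (g n 0 0)⁻¹) atTop (𝓝 1) := by simpa using h0.inv₀ one_ne_zero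
    refine Tendsto.congr' ?_ this
    filter_upwards [hne] with n hn
    have hdet := det_eq_one (g n)
    field_simp
    linarith

/-- The rotation by the angle `π` about `i`. -/
def halfTurn : SL(2, ℝ) := ⟨!![0, -1; 1, 0], by simp [Matrix.det_fin_two_of]⟩

theorem tendsto_mul_affine_halfTurn {g : ℕ → SL(2, ℝ)}
    (h0 : Tendsto (fun n => g n 0 0) atTop (𝓝 0)) (h1 : Tendsto (fun n => g n 1 0) atTop (𝓝 1)) :
    Tendsto (fun n => g n * affine (-g n 1 1 / g n 1 0) 0) atTop (𝓝 halfTurn) := by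
  have hne : ∀ᶠ n in atTop, g n 1 0 ≠ 0 := h1.eventually_ne one_ne_zero
  rw [tendsto_sl_iff]
  simp only [Fin.forall_fin_two, mul_affine_apply_zero, mul_affine_apply_one]
  refine ⟨⟨h0, ?_⟩, h1, ?_⟩
  · have : Tendsto (fun n => -(g n 1 0)⁻¹) atTop (𝓝 (-1)) := by
      have := (h1.inv₀ one_ne_zero).neg
      rwa [inv_one] at this
    refine Tendsto.congr' ?_ this
    filter_upwards [hne] with n hn
    have hdet := det_eq_one (g n)
    field_simp
    linarith
  · refine Tendsto.congr' (f₁ := fun _ => 0) ?_ tendsto_const_nhds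
    filter_upwards [hne] with n hn
    field_simp
    ring

/-! ### First columns of the generators and of the near-translations. -/

theorem tendsto_half_pow : Tendsto (fun n : ℕ => ((2 : ℝ) ^ n)⁻¹) atTop (𝓝 0) :=
  (tendsto_pow_atTop_atTop_of_one_lt (by norm_num)).inv_tendsto_atTop

theorem le_rad (n : ℕ) : 2 ^ n * endpt (2 * n + 1) ≤ rad (n + 1) := by
  have h1 := two_pow_mul_endpt_succ_le n
  have h2 := endpt_pos (2 * n + 1)
  have hE : (1 : ℝ) ≤ 2 ^ n := one_le_pow₀ (by norm_num)
  rw [pow_succ] at h1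
  simp only [rad]
  nlinarith

theorem tendsto_inv_rad : Tendsto (fun n => (rad (n + 1))⁻¹) atTop (𝓝 0) := by
  refine squeeze_zero (fun n => (inv_pos.mpr (rad_pos _)).le) (fun n => ?_) tendsto_half_pow
  apply inv_anti₀ (by positivity)
  have h1 := le_rad n
  have h2 := one_le_endpt (2 * n + 1)
  have hE : (0 : ℝ) < 2 ^ n := by positivity
  nlinarith

theorem tendsto_ctr_div_rad : Tendsto (fun n => ctr (n + 1) / rad (n + 1)) atTop (𝓝 1) := by
  have e : ∀ n, ctr (n + 1) / rad (n + 1) = 1 + endpt (2 * n + 1) / rad (n + 1) := fun n => by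
    have := (rad_pos (n + 1)).ne'
    rw [← ctr_sub_rad]
    field_simp
    ring
  simp only [e]
  have : Tendsto (fun n => endpt (2 * n + 1) / rad (n + 1)) atTop (𝓝 0) := by
    refine squeeze_zero (fun n => (div_pos (endpt_pos _) (rad_pos _)).le) (fun n => ?_)
      tendsto_half_pow
    rw [div_le_iff₀ (rad_pos _), ← div_eq_inv_mul, le_div_iff₀ (by positivity), mul_comm]
    exact le_rad n
  simpa using this.const_add 1

/-- Elements of the group that are close to translations. -/
def nearTranslation (n : ℕ) : SL(2, ℝ) := (gen n)⁻¹ * gen (n + 1)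

theorem nearTranslation_mem (n : ℕ) : nearTranslation n ∈ groupOf gen :=
  mul_mem (inv_mem (Subgroup.subset_closure ⟨n, rfl⟩)) (Subgroup.subset_closure ⟨n + 1, rfl⟩)

theorem coe_nearTranslation (n : ℕ) :
    (nearTranslation n : GL (Fin 2) ℝ) = refl (n + 1) * refl (n + 2) := by
  rw [nearTranslation, map_mul, map_inv, coe_gen, coe_gen, mul_inv_rev, refl_inv, refl_inv,
    mul_assoc, ← mul_assoc (refl 0), refl_mul_self, one_mul]

theorem nearTranslation_zero (n : ℕ) (j : Fin 2) : nearTranslation n 0 j =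
    (ctr (n + 1) * refl (n + 2) 0 j - (ctr (n + 1) ^ 2 - rad (n + 1) ^ 2) * refl (n + 2) 1 j) /
      rad (n + 1) := by
  rw [← refl_mul_zero, ← coe_nearTranslation]
  rfl

theorem nearTranslation_one (n : ℕ) (j : Fin 2) : nearTranslation n 1 j =
    (refl (n + 2) 0 j - ctr (n + 1) * refl (n + 2) 1 j) / rad (n + 1) := by
  rw [← refl_mul_one, ← coe_nearTranslation]
  rfl

theorem tendsto_nearTranslation_zero :
    Tendsto (fun n => nearTranslation n 0 0) atTop (𝓝 1) := by
  have e : ∀ n, nearTranslation n 0 0 = (ctr (n + 1) / rad (n + 1)) * (ctr (n + 2) / rad (n + 2)) -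
      ((ctr (n + 1) / rad (n + 1)) ^ 2 - 1) * (rad (n + 1) / rad (n + 2)) := fun n => by
    have h1 := (rad_pos (n + 1)).ne'
    have h2 := (rad_pos (n + 2)).ne'
    rw [nearTranslation_zero, val_refl]
    simp only [Matrix.of_apply, Matrix.cons_val', Matrix.cons_val_zero, Matrix.cons_val_one,
      Matrix.cons_val_fin_one]
    field_simp
  simp only [e]
  have h1 := tendsto_ctr_div_rad
  have h2 := (tendsto_add_atTop_iff_nat 1).mpr h1
  have h3 : Tendsto (fun n => ((ctr (n + 1) / rad (n + 1)) ^ 2 - 1) * (rad (n + 1) / rad (n + 2)))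
      atTop (𝓝 0) := by
    have h4 : Tendsto (fun n => (ctr (n + 1) / rad (n + 1)) ^ 2 - 1) atTop (𝓝 0) := by
      simpa using (h1.pow 2).sub_const 1
    have h6 : ∀ n, 0 ≤ (ctr (n + 1) / rad (n + 1)) ^ 2 - 1 := fun n => by
      have := ctr_sub_rad n
      have := endpt_pos (2 * n + 1)
      have := rad_pos (n + 1)
      rw [sub_nonneg]
      apply one_le_pow₀
      rw [one_le_div this]
      linarith
    refine squeeze_zero (fun n => mul_nonneg (h6 n) (div_pos (rad_pos _) (rad_pos _)).le)
      (fun n => mul_le_of_le_one_right (h6 n) ?_) h4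
    rw [div_le_one (rad_pos _)]
    have a := le_rad (n + 1)
    have b := ctr_add_rad (n + 1)
    have c := ctr_succ_pos n
    have d := endpt_strictMono (show 2 * (n + 1) < 2 * (n + 1) + 1 by omega)
    have hE : (1 : ℝ) ≤ 2 ^ (n + 1) := one_le_pow₀ (by norm_num)
    have f := endpt_pos (2 * (n + 1) + 1)
    have : endpt (2 * (n + 1) + 1) ≤ 2 ^ (n + 1) * endpt (2 * (n + 1) + 1) :=
      le_mul_of_one_le_left f.le hE
    linarith
  simpa using (h1.mul h2).sub h3

theorem tendsto_nearTranslation_one :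
    Tendsto (fun n => nearTranslation n 1 0) atTop (𝓝 0) := by
  have e : ∀ n, nearTranslation n 1 0 = (ctr (n + 2) / rad (n + 2)) * (rad (n + 1))⁻¹ -
      (ctr (n + 1) / rad (n + 1)) * (rad (n + 2))⁻¹ := fun n => by
    have h1 := (rad_pos (n + 1)).ne'
    have h2 := (rad_pos (n + 2)).ne'
    rw [nearTranslation_one, val_refl]
    simp only [Matrix.of_apply, Matrix.cons_val', Matrix.cons_val_zero, Matrix.cons_val_one,
      Matrix.cons_val_fin_one]
    field_simp
  simp only [e]
  have h1 := tendsto_ctr_div_rad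
  have h2 := (tendsto_add_atTop_iff_nat 1).mpr h1
  have h3 := tendsto_inv_rad
  have h4 := (tendsto_add_atTop_iff_nat 1).mpr h3
  simpa using (h2.mul h3).sub (h1.mul h4)

/-- The quotient is the real point sent to `0`, and the horocycle time used in
`tendsto_mul_affine_one`. It is at least the left endpoint `c - r` of the circle `n + 1`, hence at
least `2^n`. -/
theorem tendsto_nearTranslation_length :
    Tendsto (fun n => -nearTranslation n 0 1 / nearTranslation n 0 0) atTop atTop := by
  refine tendsto_atTop_mono (fun n => ?_)
    (tendsto_pow_atTop_atTop_of_one_lt (show (1 : ℝ) < 2 by norm_num))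
  have h1 := rad_pos (n + 1)
  have h2 := rad_pos (n + 2)
  have e : -nearTranslation n 0 1 / nearTranslation n 0 0 =
      (ctr (n + 1) * (ctr (n + 2) ^ 2 - rad (n + 2) ^ 2) -
        ctr (n + 2) * (ctr (n + 1) ^ 2 - rad (n + 1) ^ 2)) /
      (ctr (n + 1) * ctr (n + 2) - (ctr (n + 1) ^ 2 - rad (n + 1) ^ 2)) := by
    rw [nearTranslation_zero, nearTranslation_zero, val_refl]
    simp only [Matrix.of_apply, Matrix.cons_val', Matrix.cons_val_zero, Matrix.cons_val_one,
      Matrix.cons_val_fin_one]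
    field_simp
    ring
  have c1 := ctr_sub_rad n
  have c2 := ctr_sub_rad (n + 1)
  have hlt := ctr_add_rad_lt (show n + 1 < n + 2 by omega)
  have p1 := endpt_pos (2 * n + 1)
  have hp := two_pow_le_endpt n
  have hq := endpt_mul_le (show 2 * n + 1 < 2 * (n + 1) + 1 by omega)
    (show 2 ≤ 4 * (2 * n + 1 + (2 * (n + 1) + 1)) by omega)
  rw [← c1] at hp
  rw [← c1, ← c2] at hq
  rw [← c1] at p1
  change 2 ^ 2 * _ ≤ ctr (n + 2) - rad (n + 2) at hq
  rw [e]
  set c := ctr (n + 1)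
  set r := rad (n + 1)
  set C := ctr (n + 2)
  set R := rad (n + 2)
  have hden : 0 < c * C - (c ^ 2 - r ^ 2) := by nlinarith
  rw [le_div_iff₀ hden]
  have a1 : 2 ^ n * (c * C - (c ^ 2 - r ^ 2)) ≤ (c - r) * (c * C - (c ^ 2 - r ^ 2)) :=
    mul_le_mul_of_nonneg_right hp hden.le
  refine a1.trans ?_
  have b0 : 0 ≤ (c - r) * (c ^ 2 - r ^ 2) := by
    have : c ^ 2 - r ^ 2 = (c - r) * (c + r) := by ring
    rw [this]
    have : 0 < c + r := by linarith
    positivity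
  have b1 : C * (c ^ 2 - r ^ 2) ≤ 2 * (c * C) * (c - r) := by
    have : 2 * (c * C) * (c - r) - C * (c ^ 2 - r ^ 2) = C * (c - r) ^ 2 := by ring
    have : 0 ≤ C * (c - r) ^ 2 := mul_nonneg (by linarith) (sq_nonneg _)
    linarith
  have b2 : c * C * (C - R) ≤ c * (C ^ 2 - R ^ 2) := by
    have : c * (C ^ 2 - R ^ 2) - c * C * (C - R) = c * R * (C - R) := by ring
    have : 0 ≤ c * R * (C - R) :=
      mul_nonneg (mul_nonneg (by linarith) h2.le) (by linarith)
    linarith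
  have b3 : c * C * (4 * (c - r)) ≤ c * C * (C - R) :=
    mul_le_mul_of_nonneg_left (by linarith) (mul_nonneg (by linarith) (by linarith))
  have b4 : 0 ≤ c * C * (c - r) := mul_nonneg (mul_nonneg (by linarith) (by linarith)) p1.le
  linarith

/-! ## The vector and its horocycle orbit -/

/-- The projection of the unit tangent bundle of the plane to that of the surface. -/
def proj (v : UTH) : UTS (groupOf gen) := Quotient.mk _ v

theorem isOpenQuotientMap_proj : IsOpenQuotientMap proj :=
  MulAction.isOpenQuotientMap_quotientMk

theorem proj_smul {g : SL(2, ℝ)} (hg : g ∈ groupOf gen) (v : UTH) : proj (g • v) = proj v :=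
  Quotient.sound ⟨⟨g, hg⟩, rfl⟩

theorem exists_smul_of_proj_eq {v w : UTH} (h : proj v = proj w) :
    ∃ g ∈ groupOf gen, g • w = v := by
  obtain ⟨g, hg⟩ := Quotient.exact h
  exact ⟨g, g.2, hg⟩

theorem horocycleFlow_proj_upward (s t : ℝ) :
    horocycleFlow s (proj (upward 0 t)) = proj (upward (Real.exp t * s) t) := by
  change proj (horocycleFlowH s (upward 0 t)) = _
  rw [horocycleFlowH_upward, zero_add]

theorem geodesicFlow_proj_upward (t : ℝ) :
    geodesicFlow t (proj (upward 0 0)) = proj (upward 0 t) := by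
  change proj (geodesicFlowH t (upward 0 0)) = _
  rw [geodesicFlowH_upward, zero_add]

theorem geodesicPoint_proj_upward (t : ℝ) : geodesicPoint (proj (upward 0 0)) t =
    (Quotient.mk _ (upward 0 t).base : Surface (groupOf gen)) := by
  rw [geodesicPoint, geodesicFlow_proj_upward]
  rfl

theorem exists_of_proj_mem_horocycleOrbit {v : UTH}
    (h : proj v ∈ horocycleOrbit (proj (upward 0 0))) :
    ∃ g ∈ groupOf gen, ∃ s, v = g • upward s 0 := by
  obtain ⟨s, hs⟩ := h
  simp only [horocycleFlow_proj_upward] at hs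
  obtain ⟨g, hg, e⟩ := exists_smul_of_proj_eq hs.symm
  exact ⟨g, hg, _, e.symm⟩

theorem affine_smul_upward_zero (s t : ℝ) : affine s 0 • upward 0 t = upward s t := by
  rw [affine_smul_upward, mul_zero, add_zero, zero_add]

/-- The vector is itself recurrent: it is the limit of its images under the horocycle flow at times
tending to `+∞`, corrected by near-translations. -/
theorem proj_upward_mem_nonWandering (t : ℝ) :
    proj (upward 0 t) ∈ nonWandering (groupOf gen) := by
  intro U hU T
  have hpre : proj ⁻¹' U ∈ 𝓝 (upward 0 t) := isOpenQuotientMap_proj.continuous.continuousAt hU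
  have hlim : Tendsto (fun n => (nearTranslation n *
      affine (-nearTranslation n 0 1 / nearTranslation n 0 0) 0) • upward 0 t)
      atTop (𝓝 (upward 0 t)) := by
    have := (tendsto_mul_affine_one tendsto_nearTranslation_zero tendsto_nearTranslation_one).smul_const
      (upward 0 t)
    rwa [one_smul] at this
  -- At height `e^t`, time `s` of the flow shifts the real part by `e^t * s`.
  have hs : Tendsto (fun n => -nearTranslation n 0 1 / nearTranslation n 0 0 * (Real.exp t)⁻¹)
      atTop atTop :=
    tendsto_nearTranslation_length.atTop_mul_const (inv_pos.mpr (Real.exp_pos t))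
  obtain ⟨n, h1, h2⟩ := ((hlim.eventually_mem hpre).and (hs.eventually_ge_atTop T)).exists
  refine ⟨_, h2, proj (upward (-nearTranslation n 0 1 / nearTranslation n 0 0) t),
    ⟨proj (upward 0 t), mem_of_mem_nhds hU, ?_⟩, ?_⟩
  · rw [horocycleFlow_proj_upward]
    congr 2
    have := Real.exp_pos t
    field_simp
  · rw [mul_smul, affine_smul_upward_zero] at h1
    rw [← proj_smul (nearTranslation_mem n)]
    exact h1

theorem not_isHorocyclePeriodic : ¬ IsHorocyclePeriodic (proj (upward 0 0)) := by
  rintro ⟨s, hs, e⟩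
  rw [horocycleFlow_proj_upward] at e
  obtain ⟨g, hg, h⟩ := exists_smul_of_proj_eq e.symm
  have h1 := congrArg botSq h
  rw [botSq_smul_upward, ← one_smul SL(2, ℝ) (upward 0 0), botSq_smul_upward] at h1
  have h10 : g 1 0 = 0 := by
    simpa using h1
  rw [eq_one_of_lower_left_eq_zero hg h10, one_smul] at h
  have := congrArg (fun v : UTH => v.base.re) h
  simp only [upward_re, Real.exp_zero, one_mul] at this
  exact hs this

/-- The columns of `gen n` tend to `(0, 1)`, so the half turn of the vector lies in the closure; if
it were in the orbit, some element would have upper left entry `0`. -/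
theorem not_isClosed_horocycleOrbit : ¬ IsClosed (horocycleOrbit (proj (upward 0 0))) := by
  intro hcl
  have hlim : Tendsto (fun n => proj ((gen n *
      affine (-gen n 1 1 / gen n 1 0) 0) • upward 0 0)) atTop (𝓝 (proj (halfTurn • upward 0 0))) := by
    refine (isOpenQuotientMap_proj.continuous.tendsto _).comp
      ((tendsto_mul_affine_halfTurn ?_ ?_).smul_const _)
    · simpa [gen] using tendsto_inv_rad
    · simpa [gen] using tendsto_ctr_div_rad
  have hmem := hcl.mem_of_tendsto hlim (Eventually.of_forall fun n => by
    rw [mul_smul, affine_smul_upward_zero, proj_smul (Subgroup.subset_closure ⟨n, rfl⟩)]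
    exact ⟨-gen n 1 1 / gen n 1 0, by
      simp only [horocycleFlow_proj_upward, Real.exp_zero, one_mul]⟩)
  obtain ⟨g, hg, s, e⟩ := exists_of_proj_mem_horocycleOrbit hmem
  have h1 := congrArg topSq e
  rw [topSq_smul_upward, topSq_smul_upward] at h1
  have h00 : g 0 0 = 0 := by
    simp only [halfTurn, Matrix.of_apply, Matrix.cons_val', Matrix.cons_val_zero,
      Matrix.cons_val_fin_one, Real.exp_zero, one_mul] at h1
    exact pow_eq_zero_iff two_ne_zero |>.mp (by rw [← h1]; norm_num)
  exact upper_left_ne_zero hg h00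

/-- The projection is open, so the closure can be taken upstairs. There `topSq` and `botSq` are
continuous, with values `(e^t, 0)` at the limit and squared columns of the group along the orbit. -/
theorem eq_zero_of_proj_upward_mem_closure {t : ℝ}
    (h : proj (upward 0 t) ∈ closure (horocycleOrbit (proj (upward 0 0)))) : t = 0 := by
  have h' : upward 0 t ∈ closure (proj ⁻¹' horocycleOrbit (proj (upward 0 0))) := by
    rw [← isOpenQuotientMap_proj.isOpenMap.preimage_closure_eq_closure_preimage
      isOpenQuotientMap_proj.continuous]
    exact h
  have htop : topSq (upward 0 t) = Real.exp t := by
    rw [← one_smul SL(2, ℝ) (upward 0 t), topSq_smul_upward]; simp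
  have hbot : botSq (upward 0 t) = 0 := by
    rw [← one_smul SL(2, ℝ) (upward 0 t), botSq_smul_upward]; simp
  have key : Real.exp t = 1 := by
    apply eq_one_of_column_accumulates
    intro δ hδ
    have n1 : {v : UTH | |topSq v - Real.exp t| < δ} ∈ 𝓝 (upward 0 t) := by
      apply IsOpen.mem_nhds (isOpen_lt (continuous_topSq.sub continuous_const).abs continuous_const)
      simp [htop, hδ]
    have n2 : {v : UTH | botSq v < δ} ∈ 𝓝 (upward 0 t) := by
      apply IsOpen.mem_nhds (isOpen_lt continuous_botSq continuous_const)
      simp [hbot, hδ]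
    obtain ⟨v, ⟨hv1, hv2⟩, hv⟩ := mem_closure_iff_nhds.mp h' _ (inter_mem n1 n2)
    obtain ⟨g, hg, s, rfl⟩ := exists_of_proj_mem_horocycleOrbit hv
    simp only [Set.mem_ofPred_eq, topSq_smul_upward, botSq_smul_upward, Real.exp_zero,
      one_mul] at hv1 hv2
    exact ⟨g, hg, hv1, hv2⟩
  exact Real.exp_eq_one_iff t |>.mp key

theorem recurrenceTimes_eq : recurrenceTimes (proj (upward 0 0)) = {0} := by
  ext t
  simp only [recurrenceTimes, Set.mem_ofPred_eq, Set.mem_singleton_iff, geodesicFlow_proj_upward]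
  refine ⟨eq_zero_of_proj_upward_mem_closure, ?_⟩
  rintro rfl
  exact subset_closure ⟨0, by simp only [horocycleFlow_proj_upward, mul_zero]⟩

/-- The inverse of `g` has first column `(d, -c)`, and `Im (g i) = 1 / (c^2 + d^2)`. -/
theorem im_smul_le_one {g : SL(2, ℝ)} (hg : g ∈ groupOf gen) :
    (g • (upward 0 0).base).im ≤ 1 := by
  have h := one_le_column (inv_mem hg)
  rw [Matrix.SpecialLinearGroup.SL2_inv_expl] at h
  simp only [Matrix.cons_val', Matrix.cons_val_zero, Matrix.cons_val_one,
    Matrix.cons_val_fin_one] at h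
  rw [im_smul', upward_im, Real.exp_zero]
  have : ‖((g 1 0 : ℝ) : ℂ) * ((upward 0 0).base : ℂ) + (g 1 1 : ℝ)‖ ^ 2 =
      g 1 1 ^ 2 + g 1 0 ^ 2 := by
    rw [← Complex.normSq_eq_norm_sq, Complex.normSq_apply]
    simp [upward_im, upward_re]
    ring
  rw [this]
  exact div_le_one_of_le₀ (by linarith) (by positivity)

/-- The constant is `0`: no lift of the initial point is higher than `i`, and `log Im` is
1-Lipschitz. -/
theorem isQuasiMinimizing_proj : IsQuasiMinimizing (proj (upward 0 0)) := by
  refine ⟨0, le_rfl, fun t _ => ?_⟩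
  rw [geodesicPoint_proj_upward, geodesicPoint_proj_upward, sub_zero]
  refine le_csInf ⟨_, _, _, rfl, rfl, rfl⟩ ?_
  rintro _ ⟨z, w, hz, hw, rfl⟩
  obtain ⟨⟨g, hg⟩, rfl⟩ := Quotient.exact hz
  obtain ⟨⟨k, hk⟩, rfl⟩ := Quotient.exact hw
  change t ≤ dist (g • (upward 0 0).base) (k • (upward 0 t).base)
  rw [← dist_smul k⁻¹, inv_smul_smul, smul_smul]
  have h1 := im_smul_le_one (mul_mem (inv_mem hk) hg)
  have h2 := UpperHalfPlane.dist_log_im_le ((k⁻¹ * g) • (upward 0 0).base) (upward 0 t).base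
  rw [upward_im, Real.log_exp, Real.dist_eq] at h2
  have h3 := Real.log_nonpos (UpperHalfPlane.im_pos _).le h1
  have h4 := neg_abs_le (Real.log ((k⁻¹ * g) • (upward 0 0).base).im - t)
  linarith

theorem asymptoticThinness_proj : asymptoticThinness (proj (upward 0 0)) = ⊤ := by
  apply Tendsto.liminf_eq
  rw [ENNReal.tendsto_nhds_top_iff_nnreal]
  intro K
  obtain ⟨T, hT⟩ := exists_le_dist_smul_upward (K + 1)
  filter_upwards [eventually_ge_atTop T] with t ht
  have hlt : (K : ℝ≥0∞) < ENNReal.ofReal (K + 1) := by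
    rw [← ENNReal.ofReal_coe_nnreal]
    exact (ENNReal.ofReal_lt_ofReal_iff (by positivity)).mpr (by linarith)
  refine hlt.trans_le ?_
  rw [geodesicPoint_proj_upward]
  refine le_iInf fun z => le_iInf fun hz => le_iInf fun g => le_iInf fun hg => le_iInf fun hne => ?_
  obtain ⟨⟨k, hk⟩, rfl⟩ := Quotient.exact hz
  change _ ≤ edist (k • (upward 0 t).base) (g • k • (upward 0 t).base)
  rw [edist_dist]
  apply ENNReal.ofReal_le_ofReal
  -- Conjugation by `k` moves the lift to `e^t i`.
  rw [← dist_smul k⁻¹, inv_smul_smul, smul_smul, smul_smul]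
  refine hT t ht _ (mul_mem (mul_mem (inv_mem hk) hg) hk) fun h => hne.1 ?_
  have := congrArg (fun x => k * x * k⁻¹) h
  simpa [mul_assoc] using this

end Flute

end

theorem theorem1p2 :
    ∃ γ : ℕ → SL(2, ℝ), IsUntwistedFlute γ ∧ IsBisectorConstruction γ ∧
      ∃ u : UTS (groupOf γ), u ∈ nonWandering (groupOf γ) ∧ IsInfiniteQuasiMinimizing u ∧
        ¬ IsClosed (horocycleOrbit u) ∧ ¬ nonWandering (groupOf γ) ⊆ closure (horocycleOrbit u) ∧
        asymptoticThinness u = ⊤ ∧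
        recurrenceTimes u = {0} := by
  refine ⟨gen, isUntwistedFlute_gen, isBisectorConstruction_gen, proj (upward 0 0),
    proj_upward_mem_nonWandering 0,
    ⟨isQuasiMinimizing_proj, proj_upward_mem_nonWandering 0, not_isHorocyclePeriodic⟩,
    not_isClosed_horocycleOrbit, fun h => ?_, asymptoticThinness_proj, recurrenceTimes_eq⟩
  -- The vector `g_1 u` is non-wandering and outside the closure of the orbit; any nonzero time
  -- would do.
  exact one_ne_zero (eq_zero_of_proj_upward_mem_closure (h (proj_upward_mem_nonWandering 1)))
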